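/- Let $q$ be a prime power. Points of $\mathrm{PG}(2,q^3)$ have homogeneous coordinates $(x,y,z)$ over $\mathrm{GF}(q^3)$, with line at infinity $\ell_\infty: z=0$. In the Bruck–Bose representation, $\mathrm{PG}(6,q)$ is the projective space of the $7$-dimensional $\mathrm{GF}(q)$-space $\mathrm{GF}(q^3)\oplus\mathrm{GF}(q^3)\oplus\mathrm{GF}(q)$; $\Sigma_\infty$ is the hyperplane $z=0$; an affine point $(\alpha,\beta,1)$ of $\mathrm{PG}(2,q^3)$ is represented by the point $(\alpha,\beta,1)$ of $\mathrm{PG}(6,q)$, and a point $L=(\alpha,\beta,0)$ of $\ell_\infty$ by the plane $[L]=\{(\lambda\alpha,\lambda\beta,0):\lambda\in \mathrm{GF}(q^3)\}$ of a regular $2$-spread of $\Sigma_\infty$. Over $\mathrm{GF}(q^3)$ this spread has three conjugate transversal lines; a conic in a spread element, or a twisted cubic in a $3$-space which meets $\Sigma_\infty$ in a spread element, is called special if its extension to $\mathrm{GF}(q^3)$ meets the three transversals. Let $\mathscr B$ be an order-$q$-subplane of $\mathrm{PG}(2,q^3)$ (an image of $\mathrm{PG}(2,q)$ under $\mathrm{PGL}(3,q^3)$)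 that meets $\ell_\infty$ in exactly one point $T$. Its tangent splash $\mathscr S_T$ is the set of points of $\ell_\infty$ lying on the extension of some line of $\mathscr B$; "line of $\mathscr B$" means an order-$q$-subline contained in $\mathscr B$. A cover plane is a plane of $\Sigma_\infty$ that meets $[U]$ for every $U\in\mathscr S_T$. The affine points of $\mathscr B$ are represented by the affine points of a ruled surface, whose generators join corresponding points under a projectivity from a special conic $\mathcal C$ in $[T]$ to a special twisted cubic in a $3$-space that meets $\Sigma_\infty$ in a spread element other than $[T]$; such a conic, the conic directrix, exists and its point set $\mathcal C$ is uniquely determined. A tangent line of $\mathcal C$ is a line of $[T]$ with exactly one point on $\mathcal C$. If $\ell$ is a line of $\mathscr B$ with $T\notin\ell$, its points are represented by the points of a special twisted cubic $[\ell]$; for $P\in\ell$ the tangent to $[\ell]$ at $P$ meets $\Sigma_\infty$ in exactly one point $I_{P,\ell}$, which is well defined. The shadow of $[\ell]$ is the set $\mathcal D=\{I_{P,\ell}: P\in\ell\}$, which has $q+1$ points. 1. Let $P\in\mathscr B\setminus\{T\}$. The points $I_{P,\ell}$, where $\ell$ runs over the lines of $\mathscr B$ with $P\in\ell$ and $T\notin\ell$,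 are $q$ distinct points spanning a line $I_P$, and $I_P$ meets $[T]$ in exactly one point, which is a point of $\mathcal C$. 2. Let $m$ be a line of $\mathscr B$ through $T$. The lines $I_P$ with $P\in m$, $P\ne T$, are $q$ distinct lines spanning a plane $I_m$, which is a cover plane and meets $[T]$ in a tangent line of $\mathcal C$. 3. The planes $I_m$, for the lines $m$ of $\mathscr B$ through $T$, are $q+1$ distinct planes. For each $L\in\mathscr S_T\setminus\{T\}$ there is a unique line $\ell$ of $\mathscr B$ whose extension contains $L$; each plane $I_m$ meets $[L]$ in a single point, and the set of these points is the shadow $\mathcal D$ of $[\ell]$. The lines $I_m\cap[T]$ are exactly the tangent lines of $\mathcal C$, of which there are $q+1$. -/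

import Mathlib

open scoped LinearAlgebra.Projectivization TensorProduct

namespace BruckBose

/-! Throughout, `K` is the field of order `q` and `F` is its cubic extension.  A point of a
projective space is an element of a `Projectivization`; a subspace is a `Submodule` of the
underlying vector space (a line has rank 2, a plane rank 3, a 3-space rank 4), and a point `X`
lies in a subspace `W` when `X.submodule ≤ W`. -/

/-- The projective plane over `F`, with homogeneous coordinates `(x, y, z)`. -/
abbrev PG2 (F : Type*) [Field F] := ℙ F (Fin 3 → F)

/-- The seven-dimensional `K`-space of vectors `(x, y, z)` with `x, y` in `F` and `z` in `K`.
Expanding `x` and `y` in a `K`-basis of `F` gives the coordinates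
`(x₀, x₁, x₂, y₀, y₁, y₂, z)`. -/
abbrev Vec (K F : Type*) := F × F × K

/-- The projective space of dimension 6 over `K`. -/
abbrev PG6 (K F : Type*) [Field K] [Field F] [Algebra K F] := ℙ K (Vec K F)

/-! ### The plane over `F`: subplanes, their lines, and the tangent splash -/

section Plane

/-- The line at infinity `z = 0` of the plane over `F`. -/
def lineInfty (F : Type*) [Field F] : Submodule F (Fin 3 → F) :=
  LinearMap.ker (LinearMap.proj (R := F) (φ := fun _ : Fin 3 => F) 2)

/-- `B` is a subplane of order `q`: the image of the canonical subplane (points with coordinates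
in `K`) under a homography. -/
def IsSubplane (K : Type*) {F : Type*} [Field K] [Field F] [Algebra K F]
    (B : Set (PG2 F)) : Prop :=
  ∃ g : (Fin 3 → F) ≃ₗ[F] (Fin 3 → F),
    B = {P | ∃ x : Fin 3 → K, x ≠ 0 ∧
      P.submodule = Submodule.span F {g (fun i => algebraMap K F (x i))}}

/-- `B` is a subplane of order `q` meeting the line at infinity exactly in the point `T`. -/
def IsTangentSubplane (K : Type*) {F : Type*} [Field K] [Field F] [Algebra K F]
    (B : Set (PG2 F)) (T : PG2 F) : Prop :=
  IsSubplane K B ∧ {P | P ∈ B ∧ P.submodule ≤ lineInfty F} = {T}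

variable {F : Type*} [Field F]

/-- `l` is a line of the subplane `B`: the set of points of `B` on some line of the plane over
`F` that contains at least two points of `B`. -/
def IsLineOf (B l : Set (PG2 F)) : Prop :=
  l.Nontrivial ∧ ∃ W : Submodule F (Fin 3 → F), Module.finrank F W = 2 ∧
    l = {P | P ∈ B ∧ P.submodule ≤ W}

/-- The extension of a subline to a line of the plane over `F`. -/
def extLine (l : Set (PG2 F)) : Submodule F (Fin 3 → F) :=
  ⨆ P ∈ l, P.submodule

/-- The splash of `B`: the points of the line at infinity that lie on (extended) lines of `B`. -/
def splash (B : Set (PG2 F)) : Set (PG2 F) :=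
  {L | L.submodule ≤ lineInfty F ∧ ∃ l, IsLineOf B l ∧ L.submodule ≤ extLine l}

end Plane

/-! ### Rational curves given by parametrisations -/

section Curves

variable {R M : Type*} [CommRing R] [AddCommGroup M] [Module R M]

/-- The vector of the conic with coefficient vectors `d` at the parameter `(s, t)`. -/
def conicVec (d : Fin 3 → M) (s t : R) : M :=
  s ^ 2 • d 0 + (s * t) • d 1 + t ^ 2 • d 2

/-- The vector of the cubic with coefficient vectors `c` at the parameter `(s, t)`. -/
def cubicVec (c : Fin 4 → M) (s t : R) : M :=
  s ^ 3 • c 0 + (s ^ 2 * t) • c 1 + (s * t ^ 2) • c 2 + t ^ 3 • c 3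

/-- The tangent line of the cubic at the parameter `(s, t)`: the span of the point and of the two
partial derivatives.  (The point itself is needed only in characteristic 3.) -/
def cubicTangent (c : Fin 4 → M) (s t : R) : Submodule R M :=
  Submodule.span R {cubicVec c s t,
    (3 * s ^ 2) • c 0 + (2 * s * t) • c 1 + t ^ 2 • c 2,
    s ^ 2 • c 1 + (2 * s * t) • c 2 + (3 * t ^ 2) • c 3}

end Curves

/-! ### The Bruck-Bose representation -/

section Representation

variable (K : Type*) {F : Type*} [Field K] [Field F] [Algebra K F]

/-- The hyperplane at infinity `z = 0`. -/
def hypInfty (K F : Type*) [Field K] [Field F] [Algebra K F] : Submodule K (Vec K F) :=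
  LinearMap.ker ((LinearMap.snd K F K).comp (LinearMap.snd K F (F × K)))

/-- The Bruck-Bose map `(x, y, 1) ↦ (x, y, 1)` on the affine points of the plane over `F`
(it is only used for affine points). -/
noncomputable def sigma (P : PG2 F) : PG6 K F :=
  Projectivization.mk K ((P.rep 0 / P.rep 2, P.rep 1 / P.rep 2, 1) : Vec K F)
    (by simp [Prod.ext_iff])

/-- The points of the six-dimensional space that represent the affine points of `X`. -/
def affineImage (X : Set (PG2 F)) : Set (PG6 K F) :=
  sigma K '' {P | P ∈ X ∧ ¬ P.submodule ≤ lineInfty F}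

/-- The element `[L]` of the regular spread that represents the point `L` of the line at
infinity: all `(x, y, 0)` that are zero or homogeneous coordinates of `L`. -/
def spreadElt (L : PG2 F) : Submodule K (Vec K F) where
  carrier := {v | v.2.2 = 0 ∧ (![v.1, v.2.1, 0] : Fin 3 → F) ∈ L.submodule}
  add_mem' := by
    rintro a b ⟨ha, ha'⟩ ⟨hb, hb'⟩
    refine ⟨by simp [ha, hb], ?_⟩
    have := L.submodule.add_mem ha' hb'
    simpa using this
  zero_mem' := by
    refine ⟨rfl, ?_⟩
    have h : (![(0 : Vec K F).1, (0 : Vec K F).2.1, 0] : Fin 3 → F) = 0 := by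
      ext i; fin_cases i <;> rfl
    rw [h]
    exact L.submodule.zero_mem
  smul_mem' := by
    rintro k a ⟨ha, ha'⟩
    refine ⟨by simp [ha], ?_⟩
    have h : (![(k • a).1, (k • a).2.1, 0] : Fin 3 → F) =
        algebraMap K F k • ![a.1, a.2.1, 0] := by
      ext i; fin_cases i <;> simp [Algebra.smul_def]
    rw [h]
    exact L.submodule.smul_mem _ ha'

/-- Multiplication of the hyperplane at infinity by an element of `F`, preceded by the projection
that forgets `z`.  Each spread element is invariant under all these maps. -/
def spreadMul (a : F) : Vec K F →ₗ[K] Vec K F where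
  toFun v := (a * v.1, a * v.2.1, 0)
  map_add' u v := by simp [mul_add]
  map_smul' k v := by simp

/-- The three transversal lines of the regular spread, in the extension `F ⊗ Vec K F` of the
six-dimensional space to `F`.  They are indexed by the automorphisms `φ` of `F` over `K`: the
multiplications by elements `a` of `F` act on the extended hyperplane at infinity with three
two-dimensional eigenspaces, with eigenvalues `φ a`.  (For `a = 1` the condition says that the
point is in the extended hyperplane at infinity.) -/
noncomputable def transversal (φ : F ≃ₐ[K] F) : Submodule F (F ⊗[K] Vec K F) :=
  ⨅ a : F, Module.End.eigenspace ((spreadMul K a).baseChange F) (φ a)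

variable {K}

/-- The points of the conic with coefficient vectors `d`. -/
def conicPoints (d : Fin 3 → Vec K F) : Set (PG6 K F) :=
  {X | ∃ s t : K, (s, t) ≠ 0 ∧ X.submodule = Submodule.span K {conicVec d s t}}

/-- The points of the cubic with coefficient vectors `c`. -/
def cubicPoints (c : Fin 4 → Vec K F) : Set (PG6 K F) :=
  {X | ∃ s t : K, (s, t) ≠ 0 ∧ X.submodule = Submodule.span K {cubicVec c s t}}

/-- `d` parametrises a special conic in the spread element `[T]`: a nondegenerate conic of the
plane `[T]` whose extension to `F` meets the three transversals. -/
def IsSpecialConic (T : PG2 F) (d : Fin 3 → Vec K F) : Prop :=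
  LinearIndependent K d ∧ (∀ i, d i ∈ spreadElt K T) ∧
  ∀ φ : F ≃ₐ[K] F, ∃ u v : F, (u, v) ≠ 0 ∧
    conicVec (fun i => (1 : F) ⊗ₜ[K] d i) u v ∈ transversal K φ

/-- `c` parametrises a special twisted cubic in a 3-space that meets the hyperplane at infinity
exactly in the spread element `[L]`: its extension to `F` meets the three transversals. -/
def IsSpecialCubic (L : PG2 F) (c : Fin 4 → Vec K F) : Prop :=
  LinearIndependent K c ∧ Submodule.span K (Set.range c) ⊓ hypInfty K F = spreadElt K L ∧
  ∀ φ : F ≃ₐ[K] F, ∃ u v : F, (u, v) ≠ 0 ∧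
    cubicVec (fun i => (1 : F) ⊗ₜ[K] c i) u v ∈ transversal K φ

/-- The ruled surface whose generators join corresponding points of a conic and a cubic.  (Every
projectivity from the conic to the cubic is the equality of parameters after a change of the
parametrisation of one of them.) -/
def ruledSurface (d : Fin 3 → Vec K F) (c : Fin 4 → Vec K F) : Set (PG6 K F) :=
  {X | ∃ s t : K, (s, t) ≠ 0 ∧
    X.submodule ≤ Submodule.span K {conicVec d s t, cubicVec c s t}}

/-- `C` is a conic directrix in `[T]` of the ruled surface that represents the subplane `B`:
`C` is a special conic in `[T]`, there is a special twisted cubic in a 3-space about a spread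
element `[L]` other than `[T]`, and the affine points of the ruled surface given by some
projectivity between them are exactly the affine points of `B`. -/
def IsConicDirectrix (B : Set (PG2 F)) (T : PG2 F) (C : Set (PG6 K F)) : Prop :=
  ∃ (d : Fin 3 → Vec K F) (c : Fin 4 → Vec K F) (L : PG2 F),
    IsSpecialConic T d ∧ C = conicPoints d ∧
    L.submodule ≤ lineInfty F ∧ L ≠ T ∧ IsSpecialCubic L c ∧
    {X | X ∈ ruledSurface d c ∧ ¬ X.submodule ≤ hypInfty K F} = affineImage K B

/-- `t` is a tangent line of the conic `C` in the plane `[T]`: a line of that plane with exactly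
one point on `C`. -/
def IsTangentLine (T : PG2 F) (C : Set (PG6 K F)) (t : Submodule K (Vec K F)) : Prop :=
  Module.finrank K t = 2 ∧ t ≤ spreadElt K T ∧ ∃! X : PG6 K F, X ∈ C ∧ X.submodule ≤ t

/-- `π` is a cover plane of the splash of `B`: a plane of the hyperplane at infinity that meets
every element of the splash. -/
def IsCoverPlane (B : Set (PG2 F)) (π : Submodule K (Vec K F)) : Prop :=
  Module.finrank K π = 3 ∧ π ≤ hypInfty K F ∧ ∀ U ∈ splash B, π ⊓ spreadElt K U ≠ ⊥

/-- `I` is the point `I_{P,l}`: the subline `l` is represented by a special twisted cubic `[l]`,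
and the tangent line of `[l]` at `P` meets the hyperplane at infinity exactly in `I`. -/
def IsTangentTrace (P : PG2 F) (l : Set (PG2 F)) (I : PG6 K F) : Prop :=
  ∃ (c : Fin 4 → Vec K F) (L : PG2 F) (s t : K),
    L.submodule ≤ lineInfty F ∧ IsSpecialCubic L c ∧ cubicPoints c = affineImage K l ∧
    (s, t) ≠ 0 ∧ (sigma K P).submodule = Submodule.span K {cubicVec c s t} ∧
    cubicTangent c s t ⊓ hypInfty K F = I.submodule

variable (K)

/-- The points `I_{P,l}` for the lines `l` of `B` through `P` but not through `T`. -/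
def tracesAt (B : Set (PG2 F)) (T P : PG2 F) : Set (PG6 K F) :=
  {I | ∃ l, IsLineOf B l ∧ P ∈ l ∧ T ∉ l ∧ IsTangentTrace P l I}

/-- The shadow of a subline `l`: all points `I_{P,l}` with `P` on `l`. -/
def shadow (l : Set (PG2 F)) : Set (PG6 K F) :=
  {I | ∃ P ∈ l, IsTangentTrace P l I}

/-- `I_P`: the subspace spanned by the points `I_{P,l}` for fixed `P`. -/
def traceLine (B : Set (PG2 F)) (T P : PG2 F) : Submodule K (Vec K F) :=
  ⨆ I ∈ tracesAt K B T P, I.submodule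

/-- `I_m`: the subspace spanned by the lines `I_P` for the points `P ≠ T` of `m`. -/
def tracePlane (B : Set (PG2 F)) (T : PG2 F) (m : Set (PG2 F)) : Submodule K (Vec K F) :=
  ⨆ P ∈ m \ {T}, traceLine K B T P

end Representation

end BruckBose

open BruckBose

/-! In suitable coordinates (`Frame.exists_frame`) the affine points of the subplane are u + (a t +
c w)/λ, where λ = b + cτ, the parameters a, b, c lie in K, τ has degree three over K, and t, w form
an F-basis of F × F; the point T is the direction t. A line through T fixes the ratio (b : c), and
its affine points differ by K-multiples of t/λ. A line missing T is a = pb + rc; its points are u +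
pt + (c/λ)d, and it meets the line at infinity in the direction d = (r - pτ)t + w.

The norm of λ times 1/λ is a quadratic form in b, c with values in F, so these fractions really
describe conics and cubics over K. The partial derivatives of c/λ are -c/λ² and b/λ², so the tangent
at P meets infinity in d/λ² (`cubicTangent_cubicOf`). This does not depend on the parametrisation:
meeting the transversal of the identity automorphism forces every special cubic into this shape
(`exists_eq_cubicOf`), and two such parametrisations of one subline give K-proportional vectors at a
common point (`exists_smul_eq_of_subPt_eq`).

The rest is mostly linear algebra. For fixed P the directions d are (aσ + kλ)t + w with σ fixed and
k in K, so I_P is spanned by t/λ and (aσt + w)/λ². Letting a vary, I_m becomes the set of ((x + yτ)t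
+ zw)/λ² with x, y, z in K (`Frame.mem_tracePlane_iff`). It meets the spread element of d in the
multiples of d/λ², which yields both the cover property and the shadows, and it meets [T] in (K +
Kτ)t/λ².

The conic directrix is forced to be the set of all t/λ, because its points are the directions of the
generators (`Frame.eq_conic_of_isConicDirectrix`). If t/λ' lies on (K + Kτ)t/λ², then λ² = λ'(x +
yτ); as 1, τ, τ² are independent this is an identity of binary quadratic forms, and λ' is
proportional to λ (`mul_eq_mul_of_linForm_sq`). So these lines are tangents and they determine (b :
c), which gives the counts q + 1. Conversely, any other line of [T] through t/λ contains a second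
point of the conic (`Frame.exists_of_isTangentLine`). -/

namespace BruckBose

/-! ### Cubic extensions -/

section CubicField

variable {K F : Type*} [Field K] [Field F] [Algebra K F]

theorem natDegree_minpoly_eq_three (hF : Module.finrank K F = 3) {ρ : F}
    (hρ : ρ ∉ Set.range (algebraMap K F)) : (minpoly K ρ).natDegree = 3 := by
  have : FiniteDimensional K F := Module.finite_of_finrank_pos (by omega)
  have hint : IsIntegral K ρ := Algebra.IsIntegral.isIntegral ρ
  have hd : (minpoly K ρ).natDegree ∣ 3 := hF ▸ minpoly.degree_dvd hint
  rcases (Nat.dvd_prime Nat.prime_three).1 hd with h | h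
  · exact absurd (minpoly.natDegree_eq_one_iff.1 h) hρ
  · exact h

/-- The basis `1, ρ, ρ ^ 2` of a cubic extension. -/
noncomputable def cubicBasis (hF : Module.finrank K F = 3) {ρ : F}
    (hρ : ρ ∉ Set.range (algebraMap K F)) : Module.Basis (Fin 3) K F :=
  basisOfLinearIndependentOfCardEqFinrank (b := fun i : Fin 3 => ρ ^ (i : ℕ))
    (by
      have h := linearIndependent_pow (K := K) ρ
      have e := natDegree_minpoly_eq_three hF hρ
      exact h.comp (Fin.cast e.symm) (Fin.cast_injective _)) (by simp [hF])

theorem cubicBasis_apply (hF : Module.finrank K F = 3) {ρ : F}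
    (hρ : ρ ∉ Set.range (algebraMap K F)) (i : Fin 3) :
    cubicBasis hF hρ i = ρ ^ (i : ℕ) := by
  simp [cubicBasis]

theorem eq_zero_of_quadratic (hF : Module.finrank K F = 3) {ρ : F}
    (hρ : ρ ∉ Set.range (algebraMap K F)) {a b c : K}
    (h : algebraMap K F a + algebraMap K F b * ρ + algebraMap K F c * ρ ^ 2 = 0) :
    a = 0 ∧ b = 0 ∧ c = 0 := by
  have hl := Fintype.linearIndependent_iff.1 (cubicBasis hF hρ).linearIndependent ![a, b, c]
    (by simpa [Fin.sum_univ_three, cubicBasis_apply, Algebra.smul_def] using h)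
  exact ⟨hl 0, hl 1, hl 2⟩

theorem exists_quadratic (hF : Module.finrank K F = 3) {ρ : F}
    (hρ : ρ ∉ Set.range (algebraMap K F)) (y : F) :
    ∃ a b c : K, y = algebraMap K F a + algebraMap K F b * ρ + algebraMap K F c * ρ ^ 2 := by
  have h := (cubicBasis hF hρ).sum_repr y
  simp only [Fin.sum_univ_three, cubicBasis_apply, Algebra.smul_def] at h
  exact ⟨_, _, _, by simpa using h.symm⟩

/-- `ρ` is a root of the monic cubic with coefficients `T`, `E`, `N` (and alternating signs). -/
def IsCubicRoot (T E N : K) (ρ : F) : Prop :=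
  ρ ^ 3 = algebraMap K F T * ρ ^ 2 - algebraMap K F E * ρ + algebraMap K F N

theorem exists_isCubicRoot (hF : Module.finrank K F = 3) {ρ : F}
    (hρ : ρ ∉ Set.range (algebraMap K F)) : ∃ T E N : K, IsCubicRoot T E N ρ := by
  obtain ⟨a, b, c, h⟩ := exists_quadratic hF hρ (ρ ^ 3)
  exact ⟨c, -b, a, by rw [IsCubicRoot, h]; simp; ring⟩

/-- The linear form `s + t ρ`. -/
def linForm (ρ : F) (s t : K) : F := algebraMap K F s + algebraMap K F t * ρ

theorem linForm_eq_zero {ρ : F} (hρ : ρ ∉ Set.range (algebraMap K F)) {s t : K} :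
    linForm ρ s t = 0 ↔ s = 0 ∧ t = 0 := by
  constructor
  · intro h
    by_cases ht : t = 0
    · subst ht
      simpa [linForm] using h
    · refine absurd ⟨-s / t, ?_⟩ hρ
      have : algebraMap K F t ≠ 0 := by simpa using ht
      simp only [linForm] at h
      rw [map_div₀, map_neg]
      field_simp
      linear_combination -h
  · rintro ⟨rfl, rfl⟩
    simp [linForm]

theorem linForm_ne_zero {ρ : F} (hρ : ρ ∉ Set.range (algebraMap K F)) {s t : K}
    (h : (s, t) ≠ 0) : linForm ρ s t ≠ 0 := fun h0 =>
  h (by obtain ⟨rfl, rfl⟩ := (linForm_eq_zero hρ).1 h0; rfl)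

/-- The norm of `linForm`, as a cubic form. -/
def normForm (T E N s t : K) : K := s ^ 3 + T * s ^ 2 * t + E * s * t ^ 2 + N * t ^ 3

/-- The product of the two other conjugates of `linForm`, as a quadratic form. -/
def adjForm (T E : K) (ρ : F) (s t : K) : F :=
  algebraMap K F s ^ 2 + (algebraMap K F T - ρ) * algebraMap K F s * algebraMap K F t +
    (ρ ^ 2 - algebraMap K F T * ρ + algebraMap K F E) * algebraMap K F t ^ 2

/-- This trades 1/`linForm` for the polynomial `adjForm`, up to a factor in K that no projective
point notices. -/
theorem linForm_mul_adjForm {T E N : K} {ρ : F} (h : IsCubicRoot T E N ρ) (s t : K) :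
    linForm ρ s t * adjForm T E ρ s t = algebraMap K F (normForm T E N s t) := by
  simp only [linForm, adjForm, normForm, map_add, map_mul, map_pow]
  rw [IsCubicRoot] at h
  linear_combination (algebraMap K F t) ^ 3 * h

theorem adjForm_ne_zero (hF : Module.finrank K F = 3) {ρ : F}
    (hρ : ρ ∉ Set.range (algebraMap K F)) (T E : K) {s t : K} (h : (s, t) ≠ 0) :
    adjForm T E ρ s t ≠ 0 := by
  intro h0
  have := eq_zero_of_quadratic hF hρ (a := s ^ 2 + T * s * t + E * t ^ 2)
    (b := - s * t - T * t ^ 2) (c := t ^ 2) (by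
      rw [← h0]; simp only [adjForm, map_add, map_mul, map_pow, map_sub, map_neg]; ring)
  obtain ⟨h1, -, h3⟩ := this
  have ht : t = 0 := by simpa using h3
  subst ht
  have hs : s = 0 := by simpa using h1
  subst hs
  exact h rfl

theorem normForm_ne_zero (hF : Module.finrank K F = 3) {T E N : K} {ρ : F}
    (hρ : ρ ∉ Set.range (algebraMap K F)) (hc : IsCubicRoot T E N ρ) {s t : K}
    (h : (s, t) ≠ 0) : normForm T E N s t ≠ 0 := by
  intro h0
  have := linForm_mul_adjForm hc s t
  rw [h0, map_zero] at this
  exact mul_ne_zero (linForm_ne_zero hρ h) (adjForm_ne_zero hF hρ T E h) this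

/-- Comparison of coefficients: every element of the tensor product has unique coefficients in M
with respect to the K-basis 1, ρ, ρ² of F. -/
theorem tmul_quadratic_eq_zero (hF : Module.finrank K F = 3) {M : Type*} [AddCommGroup M]
    [Module K M] {ρ : F} (hρ : ρ ∉ Set.range (algebraMap K F)) {x y z : M}
    (h : (1 : F) ⊗ₜ[K] x + ρ ⊗ₜ[K] y + (ρ ^ 2) ⊗ₜ[K] z = 0) : x = 0 ∧ y = 0 ∧ z = 0 := by
  have e : (1 : F) ⊗ₜ[K] x + ρ ⊗ₜ[K] y + (ρ ^ 2) ⊗ₜ[K] z =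
      ∑ i : Fin 3, cubicBasis hF hρ i ⊗ₜ[K] (![x, y, z] i) := by
    simp [Fin.sum_univ_three, cubicBasis_apply]
  rw [e] at h
  have key : ∀ i, ![x, y, z] i = 0 := by
    intro i
    have := congrArg (fun w => TensorProduct.equivFinsuppOfBasisLeft (cubicBasis hF hρ) w i) h
    simpa [TensorProduct.equivFinsuppOfBasisLeft_apply_tmul_apply, Finsupp.single_apply,
      Finsupp.finsetSum_apply] using this
  exact ⟨key 0, key 1, key 2⟩

end CubicField

/-! ### Vectors at infinity -/

section AtInf

variable (K : Type*) {F : Type*} [Field K] [Field F] [Algebra K F]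

/-- The vector at infinity with coordinates `m`. -/
def atInf : F × F →ₗ[K] Vec K F where
  toFun m := (m.1, m.2, 0)
  map_add' u v := by simp
  map_smul' k v := by simp

variable {K}

@[simp] theorem atInf_fst (m : F × F) : (atInf K m).1 = m.1 := rfl
@[simp] theorem atInf_snd_fst (m : F × F) : (atInf K m).2.1 = m.2 := rfl
@[simp] theorem atInf_snd_snd (m : F × F) : (atInf K m).2.2 = 0 := rfl

theorem atInf_injective : Function.Injective (atInf K (F := F)) := by
  rintro ⟨a, b⟩ ⟨c, d⟩ h
  simpa [atInf] using h

theorem mem_hypInfty {v : Vec K F} : v ∈ hypInfty K F ↔ v.2.2 = 0 := Iff.rfl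

@[simp] theorem spreadMul_apply (a : F) (v : Vec K F) :
    spreadMul K a v = atInf K (a • (v.1, v.2.1)) := rfl

theorem spreadMul_atInf (a : F) (m : F × F) : spreadMul K a (atInf K m) = atInf K (a • m) := rfl

theorem vec_ext {K F : Type*} {v w : Vec K F} (h1 : v.1 = w.1) (h2 : v.2.1 = w.2.1) (h3 : v.2.2 = w.2.2) :
    v = w := Prod.ext h1 (Prod.ext h2 h3)

end AtInf

/-! ### Special conics and cubics -/

section SpecialCurves

variable {K F : Type*} [Field K] [Field F] [Algebra K F]

/-- The coefficient vectors of the conic `(adjForm s t) • m`. -/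
def conicOf (T E : K) (ρ : F) (m : F × F) : Fin 3 → Vec K F :=
  ![atInf K m, atInf K ((algebraMap K F T - ρ) • m),
    atInf K ((ρ ^ 2 - algebraMap K F T * ρ + algebraMap K F E) • m)]

/-- The coefficient vectors of the cubic `(normForm s t) • b + (t * adjForm s t) • m`. -/
def cubicOf (T E N : K) (ρ : F) (b : Vec K F) (m : F × F) : Fin 4 → Vec K F :=
  ![b, T • b + atInf K m, E • b + atInf K ((algebraMap K F T - ρ) • m),
    N • b + atInf K ((ρ ^ 2 - algebraMap K F T * ρ + algebraMap K F E) • m)]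

theorem conicVec_conicOf (T E : K) (ρ : F) (m : F × F) (s t : K) :
    conicVec (conicOf T E ρ m) s t = atInf K (adjForm T E ρ s t • m) := by
  apply vec_ext <;> simp [conicVec, conicOf, adjForm, Algebra.smul_def] <;> ring

theorem cubicVec_cubicOf' (T E N : K) (ρ : F) (b : Vec K F) (m : F × F) (s t : K) :
    cubicVec (cubicOf T E N ρ b m) s t = normForm T E N s t • b +
      atInf K ((algebraMap K F t * adjForm T E ρ s t) • m) := by
  apply vec_ext <;> simp [cubicVec, cubicOf, adjForm, normForm, Algebra.smul_def] <;> ring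

theorem cubicVec_cubicOf {T E N : K} {ρ : F} (hρ : ρ ∉ Set.range (algebraMap K F))
    (hc : IsCubicRoot T E N ρ) (b : Vec K F) (m : F × F) {s t : K} (h : (s, t) ≠ 0) :
    cubicVec (cubicOf T E N ρ b m) s t = normForm T E N s t •
      (b + atInf K ((algebraMap K F t / linForm ρ s t) • m)) := by
  have hl := linForm_ne_zero hρ h
  rw [cubicVec_cubicOf', smul_add, ← map_smul, ← algebraMap_smul F (normForm T E N s t) (_ • m),
    smul_smul, ← linForm_mul_adjForm hc]
  congr 3
  field_simp

/-- The cubic is `normForm` times the moving point e = b + (t/λ)m with λ = s + tρ. By the product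
rule its partial derivatives are combinations of e and of the derivatives of t/λ, which are -t/λ²
and s/λ². -/
theorem cubicTangent_cubicOf (hF : Module.finrank K F = 3) {T E N : K} {ρ : F}
    (hρ : ρ ∉ Set.range (algebraMap K F))
    (hc : IsCubicRoot T E N ρ) (b : Vec K F) (m : F × F) {s t : K} (h : (s, t) ≠ 0) :
    cubicTangent (cubicOf T E N ρ b m) s t = Submodule.span K
      {b + atInf K ((algebraMap K F t / linForm ρ s t) • m),
        atInf K ((1 / linForm ρ s t ^ 2) • m)} := by
  have hl := linForm_ne_zero hρ h
  have hn := normForm_ne_zero hF hρ hc h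
  set e : Vec K F := b + atInf K ((algebraMap K F t / linForm ρ s t) • m) with he
  set i : Vec K F := atInf K ((1 / linForm ρ s t ^ 2) • m) with hi
  have hp : cubicVec (cubicOf T E N ρ b m) s t = normForm T E N s t • e :=
    cubicVec_cubicOf hρ hc b m h
  have key := linForm_mul_adjForm hc s t
  rw [IsCubicRoot] at hc
  -- Product rule in s: the coefficient of e is the s-derivative of `normForm`.
  have hs : (3 * s ^ 2) • cubicOf T E N ρ b m 0 + (2 * s * t) • cubicOf T E N ρ b m 1 +
      t ^ 2 • cubicOf T E N ρ b m 2 =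
      (3 * s ^ 2 + 2 * T * s * t + E * t ^ 2) • e + (-(t * normForm T E N s t)) • i := by
    have hcoef : algebraMap K F (2 * s * t) + algebraMap K F (t ^ 2) * (algebraMap K F T - ρ) =
        algebraMap K F (3 * s ^ 2 + 2 * T * s * t + E * t ^ 2) *
          (algebraMap K F t / linForm ρ s t) -
        algebraMap K F (t * normForm T E N s t) * (1 / linForm ρ s t ^ 2) := by
      rw [map_mul _ t, ← key]
      field_simp
      simp only [linForm, adjForm, map_add, map_mul, map_pow, map_ofNat]
      ring
    apply vec_ext
    · simp [he, hi, cubicOf, Algebra.smul_def]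
      simp only [map_add, map_mul, map_pow, map_ofNat] at hcoef ⊢
      linear_combination m.1 * hcoef
    · simp [he, hi, cubicOf, Algebra.smul_def]
      simp only [map_add, map_mul, map_pow, map_ofNat] at hcoef ⊢
      linear_combination m.2 * hcoef
    · simp [he, hi, cubicOf]
      ring
  have ht : s ^ 2 • cubicOf T E N ρ b m 1 + (2 * s * t) • cubicOf T E N ρ b m 2 +
      (3 * t ^ 2) • cubicOf T E N ρ b m 3 =
      (T * s ^ 2 + 2 * E * s * t + 3 * N * t ^ 2) • e + (s * normForm T E N s t) • i := by
    have hcoef : algebraMap K F (s ^ 2) +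
        algebraMap K F (2 * s * t) * (algebraMap K F T - ρ) +
        algebraMap K F (3 * t ^ 2) * (ρ ^ 2 - algebraMap K F T * ρ + algebraMap K F E) =
        algebraMap K F (T * s ^ 2 + 2 * E * s * t + 3 * N * t ^ 2) *
          (algebraMap K F t / linForm ρ s t) +
        algebraMap K F (s * normForm T E N s t) * (1 / linForm ρ s t ^ 2) := by
      rw [map_mul _ s, ← key]
      field_simp
      simp only [linForm, adjForm, map_add, map_mul, map_pow, map_ofNat]
      linear_combination (3 * (algebraMap K F t) ^ 3) * hc
    apply vec_ext
    · simp [he, hi, cubicOf, Algebra.smul_def]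
      simp only [map_add, map_mul, map_pow, map_ofNat] at hcoef ⊢
      linear_combination m.1 * hcoef
    · simp [he, hi, cubicOf, Algebra.smul_def]
      simp only [map_add, map_mul, map_pow, map_ofNat] at hcoef ⊢
      linear_combination m.2 * hcoef
    · simp [he, hi, cubicOf]
      ring
  rw [cubicTangent, hp, hs, ht]
  have me : e ∈ Submodule.span K {e, i} := Submodule.subset_span (by simp)
  have mi : i ∈ Submodule.span K {e, i} := Submodule.subset_span (by simp)
  apply le_antisymm
  · rw [Submodule.span_le]
    rintro x (rfl | rfl | rfl)
    · exact Submodule.smul_mem _ _ me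
    · exact add_mem (Submodule.smul_mem _ _ me) (Submodule.smul_mem _ _ mi)
    · exact add_mem (Submodule.smul_mem _ _ me) (Submodule.smul_mem _ _ mi)
  · set S := Submodule.span K {normForm T E N s t • e,
      (3 * s ^ 2 + 2 * T * s * t + E * t ^ 2) • e + (-(t * normForm T E N s t)) • i,
      (T * s ^ 2 + 2 * E * s * t + 3 * N * t ^ 2) • e + (s * normForm T E N s t) • i} with hS
    have m1 : normForm T E N s t • e ∈ S := Submodule.subset_span (by simp)
    have m2 : (3 * s ^ 2 + 2 * T * s * t + E * t ^ 2) • e +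
      (-(t * normForm T E N s t)) • i ∈ S := Submodule.subset_span (by simp)
    have m3 : (T * s ^ 2 + 2 * E * s * t + 3 * N * t ^ 2) • e +
      (s * normForm T E N s t) • i ∈ S := Submodule.subset_span (by simp)
    have m0 : e ∈ S := (Submodule.smul_mem_iff _ hn).1 m1
    have m4 := (Submodule.add_mem_iff_right S (Submodule.smul_mem _ _ m0)).1 m2
    have m5 := (Submodule.add_mem_iff_right S (Submodule.smul_mem _ _ m0)).1 m3
    -- The derivatives contain i with coefficients -tN and sN, where N is the nonzero value of
    -- `normForm`; one of them is nonzero.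
    have m6 : i ∈ S := by
      by_cases ht0 : t = 0
      · have hs0 : s ≠ 0 := by rintro rfl; exact h (by simp [ht0])
        exact (Submodule.smul_mem_iff _ (mul_ne_zero hs0 hn)).1 m5
      · exact (Submodule.smul_mem_iff _ (neg_ne_zero.2 (mul_ne_zero ht0 hn))).1 m4
    rw [Submodule.span_le]
    rintro x (rfl | rfl)
    · exact m0
    · exact m6

theorem span_pair_inf_hypInfty {e i : Vec K F} (he : e.2.2 ≠ 0) (hi : i.2.2 = 0) :
    Submodule.span K {e, i} ⊓ hypInfty K F = Submodule.span K {i} := by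
  ext v
  rw [Submodule.mem_inf, Submodule.mem_span_pair, mem_hypInfty, Submodule.mem_span_singleton]
  constructor
  · rintro ⟨⟨a, b, rfl⟩, h⟩
    have : a = 0 := by simpa [hi, he] using h
    exact ⟨b, by simp [this]⟩
  · rintro ⟨b, rfl⟩
    exact ⟨⟨0, b, by simp⟩, by simp [hi]⟩

theorem mem_transversal {φ : F ≃ₐ[K] F} {w : F ⊗[K] Vec K F} :
    w ∈ transversal K φ ↔ ∀ a : F, (spreadMul K a).baseChange F w = φ a • w := by
  simp [transversal, Submodule.mem_iInf]

/-- Let f be the cubic with root ρ. The quotient f(X)/(X - ρ) is X² - (T - ρ)X + (ρ² - Tρ + E), and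
the vector is its value at X = φ ρ, with φ ρ acting on the left factor and ρ on the right. Since f(φ
ρ) = 0, the difference of these two actions kills it, so it is an eigenvector for ρ with eigenvalue
φ ρ. -/
theorem mem_transversal_of_root (hF : Module.finrank K F = 3) {T E N : K} {ρ : F}
    (hρ : ρ ∉ Set.range (algebraMap K F)) (hc : IsCubicRoot T E N ρ) (φ : F ≃ₐ[K] F)
    (m : F × F) :
    (1 : F) ⊗ₜ[K] atInf K ((ρ ^ 2 - algebraMap K F T * ρ + algebraMap K F E) • m) -
      φ ρ ⊗ₜ[K] atInf K ((algebraMap K F T - ρ) • m) + (φ ρ ^ 2) ⊗ₜ[K] atInf K m ∈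
      transversal K φ := by
  set w := (1 : F) ⊗ₜ[K] atInf K ((ρ ^ 2 - algebraMap K F T * ρ + algebraMap K F E) • m) -
      φ ρ ⊗ₜ[K] atInf K ((algebraMap K F T - ρ) • m) + (φ ρ ^ 2) ⊗ₜ[K] atInf K m with hw
  rw [IsCubicRoot] at hc
  have hφ : φ ρ ^ 3 = algebraMap K F T * φ ρ ^ 2 - algebraMap K F E * φ ρ +
      algebraMap K F N := by
    rw [← map_pow, hc]; simp
  have h1 : (spreadMul K (1 : F)).baseChange F w = w := by
    simp only [hw, map_add, map_sub, LinearMap.baseChange_tmul, spreadMul_atInf, one_smul]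
  have hr : (spreadMul K ρ).baseChange F w = φ ρ • w := by
    have e1 : ρ • (ρ ^ 2 - algebraMap K F T * ρ + algebraMap K F E) • m = N • m := by
      rw [smul_smul, ← algebraMap_smul F N m]
      congr 1; linear_combination hc
    have e2 : (φ ρ ^ 3) ⊗ₜ[K] atInf K m = (φ ρ ^ 2) ⊗ₜ[K] (T • atInf K m) -
        φ ρ ⊗ₜ[K] (E • atInf K m) + (1 : F) ⊗ₜ[K] (N • atInf K m) := by
      rw [hφ, TensorProduct.add_tmul, TensorProduct.sub_tmul, ← Algebra.smul_def,
        ← Algebra.smul_def, Algebra.algebraMap_eq_smul_one]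
      simp only [TensorProduct.smul_tmul]
    have e3 : ρ • m = T • m - (algebraMap K F T - ρ) • m := by
      rw [sub_smul, algebraMap_smul]; abel
    have e4 : (ρ ^ 2 - algebraMap K F T * ρ + algebraMap K F E) • m =
      E • m - ρ • (algebraMap K F T - ρ) • m := by
      rw [smul_smul, ← algebraMap_smul F E m, ← sub_smul]
      congr 1; ring
    have lhs : (spreadMul K ρ).baseChange F w = (1 : F) ⊗ₜ[K] (N • atInf K m) -
        φ ρ ⊗ₜ[K] atInf K (ρ • (algebraMap K F T - ρ) • m) +
        (φ ρ ^ 2) ⊗ₜ[K] atInf K (ρ • m) := by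
      rw [← map_smul (atInf K), ← e1]
      simp only [hw, map_add, map_sub, LinearMap.baseChange_tmul, spreadMul_atInf]
    have rhs : φ ρ • w = φ ρ ⊗ₜ[K] atInf K
          ((ρ ^ 2 - algebraMap K F T * ρ + algebraMap K F E) • m) -
        (φ ρ ^ 2) ⊗ₜ[K] atInf K ((algebraMap K F T - ρ) • m) +
        (φ ρ ^ 3) ⊗ₜ[K] atInf K m := by
      rw [hw, smul_add, smul_sub]
      simp only [TensorProduct.smul_tmul', smul_eq_mul, mul_one]
      ring_nf
    rw [lhs, rhs, e2, e3, e4]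
    simp only [map_sub, map_smul, TensorProduct.tmul_sub]
    abel
  rw [mem_transversal]
  intro a
  obtain ⟨x, y, z, rfl⟩ := exists_quadratic hF hρ a
  -- Multiplication by any element is a quadratic polynomial in multiplication by ρ, so the
  -- eigenvalue equations for 1 and ρ suffice. The constant term uses `spreadMul K 1`, which is not
  -- the identity because it forgets z.
  have hsum : spreadMul K (algebraMap K F x + algebraMap K F y * ρ + algebraMap K F z * ρ ^ 2) =
      x • spreadMul K (1 : F) + y • spreadMul K ρ + z • (spreadMul K ρ ∘ₗ spreadMul K ρ) := by
    ext v <;> simp [Algebra.smul_def] <;> ring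
  rw [hsum]
  simp only [LinearMap.baseChange_add, LinearMap.baseChange_smul, LinearMap.baseChange_comp,
    LinearMap.add_apply, LinearMap.smul_apply, LinearMap.comp_apply, h1, hr, map_smul]
  simp only [map_add, map_mul, AlgEquiv.commutes, add_smul, mul_smul, algebraMap_smul,
    pow_two]


/-- The coefficients of `adjForm` arise from 1, ρ, ρ² by a triangular change with diagonal entries
±1, so they too form a K-basis of F. -/
theorem exists_eq_adjBasis (hF : Module.finrank K F = 3) {ρ : F}
    (hρ : ρ ∉ Set.range (algebraMap K F)) (T E : K) (a : F) :
    ∃ x y z : K, a = algebraMap K F x + algebraMap K F y * (algebraMap K F T - ρ) +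
      algebraMap K F z * (ρ ^ 2 - algebraMap K F T * ρ + algebraMap K F E) := by
  obtain ⟨x, y, z, rfl⟩ := exists_quadratic hF hρ a
  refine ⟨x + (y + T * z) * T - z * E, -(y + T * z), z, ?_⟩
  simp only [map_add, map_sub, map_mul, map_neg]
  ring

theorem adjBasis_eq_zero (hF : Module.finrank K F = 3) {ρ : F}
    (hρ : ρ ∉ Set.range (algebraMap K F)) {T E x y z : K}
    (h : algebraMap K F x + algebraMap K F y * (algebraMap K F T - ρ) +
      algebraMap K F z * (ρ ^ 2 - algebraMap K F T * ρ + algebraMap K F E) = 0) :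
    x = 0 ∧ y = 0 ∧ z = 0 := by
  have := eq_zero_of_quadratic hF hρ (a := x + y * T + z * E) (b := - y - z * T) (c := z) (by
    rw [← h]; simp only [map_add, map_sub, map_mul, map_neg]; ring)
  obtain ⟨h1, h2, rfl⟩ := this
  have hy : y = 0 := by simpa using h2
  subst hy
  exact ⟨by simpa using h1, rfl, rfl⟩

theorem mem_spreadElt_iff {L : PG2 F} {m : F × F}
    (hL : L.submodule = Submodule.span F {![m.1, m.2, 0]}) {v : Vec K F} :
    v ∈ spreadElt K L ↔ ∃ a : F, v = atInf K (a • m) := by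
  change (v.2.2 = 0 ∧ (![v.1, v.2.1, 0] : Fin 3 → F) ∈ L.submodule) ↔ _
  rw [hL, Submodule.mem_span_singleton]
  constructor
  · rintro ⟨h, a, ha⟩
    refine ⟨a, vec_ext ?_ ?_ (by simp [h])⟩
    · simpa using (congrFun ha 0).symm
    · simpa using (congrFun ha 1).symm
  · rintro ⟨a, rfl⟩
    exact ⟨by simp, a, by ext i; fin_cases i <;> simp⟩

theorem exists_submodule_eq_span {L : PG2 F} (hL : L.submodule ≤ lineInfty F) :
    ∃ m : F × F, m ≠ 0 ∧ L.submodule = Submodule.span F {![m.1, m.2, 0]} := by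
  have h2 : L.rep 2 = 0 := by
    have : L.rep ∈ L.submodule := by
      rw [Projectivization.submodule_eq]; exact Submodule.mem_span_singleton_self _
    exact hL this
  have e : ![L.rep 0, L.rep 1, 0] = L.rep := by
    ext i; fin_cases i <;> simp [h2]
  refine ⟨(L.rep 0, L.rep 1), ?_, ?_⟩
  · intro h
    apply L.rep_nonzero
    rw [← e]
    simp only [Prod.mk_eq_zero] at h
    ext i; fin_cases i <;> simp [h.1, h.2]
  · rw [Projectivization.submodule_eq]
    exact congrArg (fun v => Submodule.span F {v}) e.symm

theorem sum_smul_conicOf (T E : K) (ρ : F) (m : F × F) (g : Fin 3 → K) :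
    ∑ i, g i • conicOf T E ρ m i = atInf K ((algebraMap K F (g 0) +
      algebraMap K F (g 1) * (algebraMap K F T - ρ) +
      algebraMap K F (g 2) * (ρ ^ 2 - algebraMap K F T * ρ + algebraMap K F E)) • m) := by
  apply vec_ext <;> simp [Fin.sum_univ_three, conicOf, Algebra.smul_def] <;> ring

theorem sum_smul_cubicOf (T E N : K) (ρ : F) (b : Vec K F) (m : F × F) (g : Fin 4 → K) :
    ∑ i, g i • cubicOf T E N ρ b m i = (g 0 + g 1 * T + g 2 * E + g 3 * N) • b +
      atInf K ((algebraMap K F (g 1) +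
      algebraMap K F (g 2) * (algebraMap K F T - ρ) +
      algebraMap K F (g 3) * (ρ ^ 2 - algebraMap K F T * ρ + algebraMap K F E)) • m) := by
  apply vec_ext <;> simp [Fin.sum_univ_four, cubicOf, Algebra.smul_def] <;> ring

theorem smul_add_atInf_eq_zero {b : Vec K F} (hb : b.2.2 ≠ 0) {m : F × F} (hm : m ≠ 0) {k : K}
    {a : F} (h : k • b + atInf K (a • m) = 0) : k = 0 ∧ a = 0 := by
  have hk : k = 0 := by
    have := congrArg (fun v : Vec K F => v.2.2) h
    simpa [hb] using this
  subst hk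
  rw [zero_smul, zero_add, map_eq_zero_iff _ atInf_injective, smul_eq_zero] at h
  exact ⟨rfl, h.resolve_right hm⟩

theorem isSpecialConic_conicOf (hF : Module.finrank K F = 3) {T E N : K} {ρ : F}
    (hρ : ρ ∉ Set.range (algebraMap K F)) (hc : IsCubicRoot T E N ρ) {m : F × F} (hm : m ≠ 0)
    {L : PG2 F} (hL : L.submodule = Submodule.span F {![m.1, m.2, 0]}) :
    IsSpecialConic L (conicOf T E ρ m) := by
  -- At the parameter (-φ ρ, 1) the conic vector is exactly the eigenvector of
  -- `mem_transversal_of_root`.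
  refine ⟨?_, ?_, fun φ => ⟨-φ ρ, 1, by simp, ?_⟩⟩
  · rw [Fintype.linearIndependent_iff]
    intro g hg
    rw [sum_smul_conicOf, map_eq_zero_iff _ atInf_injective, smul_eq_zero] at hg
    obtain ⟨h0, h1, h2⟩ := adjBasis_eq_zero hF hρ (hg.resolve_right hm)
    intro i; fin_cases i <;> assumption
  · intro i
    rw [mem_spreadElt_iff hL]
    fin_cases i
    · exact ⟨1, by simp [conicOf]⟩
    · exact ⟨_, rfl⟩
    · exact ⟨_, rfl⟩
  · convert mem_transversal_of_root hF hρ hc φ m using 1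
    simp only [conicVec, conicOf, TensorProduct.smul_tmul', smul_eq_mul, mul_one,
      Matrix.cons_val_zero, Matrix.cons_val_one, Matrix.cons_val, neg_sq, one_pow,
      TensorProduct.neg_tmul]
    abel

theorem isSpecialCubic_cubicOf (hF : Module.finrank K F = 3) {T E N : K} {ρ : F}
    (hρ : ρ ∉ Set.range (algebraMap K F)) (hc : IsCubicRoot T E N ρ) {b : Vec K F}
    (hb : b.2.2 ≠ 0) {m : F × F} (hm : m ≠ 0)
    {L : PG2 F} (hL : L.submodule = Submodule.span F {![m.1, m.2, 0]}) :
    IsSpecialCubic L (cubicOf T E N ρ b m) := by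
  refine ⟨?_, ?_, fun φ => ⟨-φ ρ, 1, by simp, ?_⟩⟩
  · rw [Fintype.linearIndependent_iff]
    intro g hg
    rw [sum_smul_cubicOf] at hg
    obtain ⟨hk, ha⟩ := smul_add_atInf_eq_zero hb hm hg
    obtain ⟨h0, h1, h2⟩ := adjBasis_eq_zero hF hρ ha
    have h3 : g 0 = 0 := by simpa [h0, h1, h2] using hk
    intro i; fin_cases i <;> assumption
  · ext v
    rw [Submodule.mem_inf, Submodule.mem_span_range_iff_exists_fun, mem_hypInfty,
      mem_spreadElt_iff hL]
    constructor
    · rintro ⟨⟨g, rfl⟩, h⟩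
      rw [sum_smul_cubicOf] at h ⊢
      have hk : g 0 + g 1 * T + g 2 * E + g 3 * N = 0 := by simpa [hb] using h
      exact ⟨_, by rw [hk, zero_smul, zero_add]⟩
    · rintro ⟨a, rfl⟩
      obtain ⟨x, y, z, rfl⟩ := exists_eq_adjBasis hF hρ T E a
      -- The first coefficient is chosen to cancel the multiples of b carried by the other three
      -- coefficient vectors.
      refine ⟨⟨![-(x * T + y * E + z * N), x, y, z], ?_⟩, by simp⟩
      rw [sum_smul_cubicOf]
      simp only [Matrix.cons_val_zero, Matrix.cons_val_one, Matrix.cons_val]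
      convert zero_add _
      rw [show -(x * T + y * E + z * N) + x * T + y * E + z * N = 0 by ring, zero_smul]
  · convert mem_transversal_of_root hF hρ hc φ m using 1
    have hφ : φ ρ ^ 3 = algebraMap K F T * φ ρ ^ 2 - algebraMap K F E * φ ρ +
        algebraMap K F N := by
      rw [← map_pow, hc]; simp
    -- The norm form vanishes at (-φ ρ, 1), so b drops out and only the eigenvector remains.
    have e : ((-φ ρ) ^ 3) ⊗ₜ[K] b = - ((φ ρ ^ 2) ⊗ₜ[K] (T • b)) + φ ρ ⊗ₜ[K] (E • b) -
        (1 : F) ⊗ₜ[K] (N • b) := by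
      rw [show (-φ ρ) ^ 3 = - (T • φ ρ ^ 2) + E • φ ρ - N • (1 : F) by
        simp only [Algebra.smul_def]; linear_combination - hφ]
      rw [TensorProduct.sub_tmul, TensorProduct.add_tmul, TensorProduct.neg_tmul]
      simp only [TensorProduct.smul_tmul]
    simp only [cubicVec, cubicOf, TensorProduct.smul_tmul', smul_eq_mul, mul_one,
      Matrix.cons_val_zero, Matrix.cons_val_one, Matrix.cons_val, neg_sq, one_pow,
      e, TensorProduct.tmul_add, smul_add]
    rw [TensorProduct.neg_tmul, TensorProduct.neg_tmul]
    abel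

theorem cubicVec_ne_zero {c : Fin 4 → Vec K F} (hc : LinearIndependent K c) {s t : K}
    (h : (s, t) ≠ 0) : cubicVec c s t ≠ 0 := by
  intro h0
  have := Fintype.linearIndependent_iff.1 hc ![s ^ 3, s ^ 2 * t, s * t ^ 2, t ^ 3]
    (by simpa [Fin.sum_univ_four, cubicVec] using h0)
  have hs : s = 0 := by simpa using this 0
  have ht : t = 0 := by simpa using this 3
  exact h (by rw [hs, ht]; rfl)

theorem conicVec_ne_zero {c : Fin 3 → Vec K F} (hc : LinearIndependent K c) {s t : K}
    (h : (s, t) ≠ 0) : conicVec c s t ≠ 0 := by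
  intro h0
  have := Fintype.linearIndependent_iff.1 hc ![s ^ 2, s * t, t ^ 2]
    (by simpa [Fin.sum_univ_three, conicVec] using h0)
  have hs : s = 0 := by simpa using this 0
  have ht : t = 0 := by simpa using this 2
  exact h (by rw [hs, ht]; rfl)

theorem exists_not_mem_range (hF : Module.finrank K F = 3) :
    ∃ a : F, a ∉ Set.range (algebraMap K F) := by
  by_contra! h
  have hs : Function.Surjective (Algebra.linearMap K F) := h
  have := LinearMap.finrank_le_finrank_of_surjective hs
  rw [hF, Module.finrank_self] at this
  omega

/-- A point of the transversal indexed by the identity is not a multiple of a rational point. -/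
theorem not_mem_transversal_refl (hF : Module.finrank K F = 3) {x : Vec K F} (hx : x ≠ 0)
    {μ : F} (hμ : μ ≠ 0) : μ • ((1 : F) ⊗ₜ[K] x) ∉ transversal K (AlgEquiv.refl : F ≃ₐ[K] F) := by
  intro h
  have h := (Submodule.smul_mem_iff _ hμ).1 h
  rw [mem_transversal] at h
  obtain ⟨a, ha⟩ := exists_not_mem_range hF
  have h := h a
  rw [LinearMap.baseChange_tmul, TensorProduct.smul_tmul', smul_eq_mul, mul_one] at h
  have := tmul_quadratic_eq_zero hF ha (x := spreadMul K a x) (y := -x) (z := 0) (by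
    rw [h, TensorProduct.tmul_neg]; simp)
  exact hx (neg_eq_zero.1 this.2.1)

/-- Only the transversal of the identity automorphism is needed. The cubic meets it at a parameter
that cannot be rational, and -u/v serves as ρ. Reducing modulo the cubic equation of ρ and comparing
coefficients of 1, ρ, ρ² in the eigenvalue equation expresses all coefficient vectors by `c 0` and
one direction m. -/
theorem exists_eq_cubicOf (hF : Module.finrank K F = 3) {L : PG2 F}
    (hLi : L.submodule ≤ lineInfty F) {c : Fin 4 → Vec K F} (h : IsSpecialCubic L c) :
    ∃ (T E N : K) (ρ : F) (b : Vec K F) (m : F × F), ρ ∉ Set.range (algebraMap K F) ∧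
      IsCubicRoot T E N ρ ∧ b.2.2 ≠ 0 ∧ m ≠ 0 ∧ c = cubicOf T E N ρ b m := by
  obtain ⟨hli, hinf, htr⟩ := h
  obtain ⟨u, v, huv, hw⟩ := htr AlgEquiv.refl
  -- A parameter proportional to a rational one would put a rational point on the transversal.
  have hrat : ∀ (μ : F) (s t : K), (s, t) ≠ 0 → μ ≠ 0 → u = μ * algebraMap K F s →
      v = μ * algebraMap K F t → False := by
    rintro μ s t hst hμ rfl rfl
    refine not_mem_transversal_refl hF (cubicVec_ne_zero hli hst) (pow_ne_zero 3 hμ) ?_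
    convert hw using 1
    have hk : ∀ (k : K) (x : Vec K F), (μ ^ 3) ⊗ₜ[K] (k • x) =
        (μ ^ 3 * algebraMap K F k) ⊗ₜ[K] x := by
      intro k x
      rw [← TensorProduct.smul_tmul, Algebra.smul_def, mul_comm]
    simp only [cubicVec, TensorProduct.smul_tmul', smul_eq_mul, mul_one, TensorProduct.tmul_add,
      smul_add, hk, map_pow, map_mul]
    ring_nf
  have hv : v ≠ 0 := by
    rintro rfl
    have hu : u ≠ 0 := fun h => huv (by simp [h])
    exact hrat u 1 0 (by simp) hu (by simp) (by simp)
  obtain ⟨ρ, rfl⟩ : ∃ ρ, u = v * -ρ := ⟨-(u / v), by field_simp⟩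
  have hρ : ρ ∉ Set.range (algebraMap K F) := by
    rintro ⟨k, rfl⟩
    exact hrat v (-k) 1 (by simp) hv (by simp) (by simp)
  obtain ⟨T, E, N, hroot⟩ := exists_isCubicRoot hF hρ
  set m2 : Vec K F := c 1 - T • c 0 with hm2
  set m1 : Vec K F := E • c 0 - c 2 with hm1
  set m0 : Vec K F := c 3 - N • c 0 with hm0
  have hroot' : ρ ^ 3 = T • ρ ^ 2 - E • ρ + N • (1 : F) := by
    rw [IsCubicRoot] at hroot
    simp only [Algebra.smul_def, mul_one, hroot]
  have cube : ∀ x : Vec K F, (ρ ^ 3) ⊗ₜ[K] x = (ρ ^ 2) ⊗ₜ[K] (T • x) - ρ ⊗ₜ[K] (E • x) +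
      (1 : F) ⊗ₜ[K] (N • x) := by
    intro x
    rw [hroot', TensorProduct.add_tmul, TensorProduct.sub_tmul]
    simp only [TensorProduct.smul_tmul]
  have hw' : (1 : F) ⊗ₜ[K] m0 + ρ ⊗ₜ[K] m1 + (ρ ^ 2) ⊗ₜ[K] m2 ∈
      transversal K (AlgEquiv.refl : F ≃ₐ[K] F) := by
    rw [← Submodule.smul_mem_iff _ (pow_ne_zero 3 hv)]
    convert hw using 1
    have e : cubicVec (fun i => (1 : F) ⊗ₜ[K] c i) (v * -ρ) v = v ^ 3 •
        (- ((ρ ^ 3) ⊗ₜ[K] c 0) + (ρ ^ 2) ⊗ₜ[K] c 1 - ρ ⊗ₜ[K] c 2 + (1 : F) ⊗ₜ[K] c 3) := by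
      simp only [cubicVec, TensorProduct.smul_tmul', smul_eq_mul, mul_one, smul_add,
        ← TensorProduct.neg_tmul, sub_eq_add_neg]
      ring_nf
    rw [e, cube, hm0, hm1, hm2]
    simp only [TensorProduct.tmul_sub]
    abel_nf
  rw [mem_transversal] at hw'
  simp only [map_add, LinearMap.baseChange_tmul, smul_add, TensorProduct.smul_tmul', smul_eq_mul,
    mul_one, AlgEquiv.coe_refl, id_eq] at hw'
  have hz := hw' 1
  obtain ⟨hz0, hz1, hz2⟩ := tmul_quadratic_eq_zero hF hρ
    (x := spreadMul K (1 : F) m0 - m0) (y := spreadMul K (1 : F) m1 - m1)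
    (z := spreadMul K (1 : F) m2 - m2) (by
      simp only [TensorProduct.tmul_sub]
      rw [one_mul, one_mul] at hz
      rw [← sub_eq_zero] at hz
      rw [← hz]; abel)
  -- The eigenvalue is ρ itself; the coefficients of ρ² and ρ give ρ·m2 = m1 + T·m2 and ρ·m1 = m0 -
  -- E·m2, which determine m1 and m0 from m2.
  have hr := hw' ρ
  rw [show ρ * ρ ^ 2 = ρ ^ 3 by ring, show ρ * ρ = ρ ^ 2 by ring, cube] at hr
  obtain ⟨hr0, hr1, hr2⟩ := tmul_quadratic_eq_zero hF hρ
    (x := spreadMul K ρ m0 - N • m2) (y := spreadMul K ρ m1 - m0 + E • m2)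
    (z := spreadMul K ρ m2 - m1 - T • m2) (by
      simp only [TensorProduct.tmul_sub, TensorProduct.tmul_add]
      rw [← sub_eq_zero] at hr
      rw [← hr]; abel)
  set m : F × F := (m2.1, m2.2.1) with hm
  have e2 : m2 = atInf K m := by
    rw [← sub_eq_zero.1 hz2, spreadMul_apply, one_smul]
  have e1 : m1 = - atInf K ((algebraMap K F T - ρ) • m) := by
    have : m1 = spreadMul K ρ m2 - T • m2 := by
      rw [← sub_eq_zero, ← neg_eq_zero, ← hr2]; abel
    rw [this, e2, spreadMul_atInf, ← map_smul, ← map_sub, ← map_neg, ← algebraMap_smul F T m,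
      ← sub_smul, ← neg_smul, neg_sub]
  have e0 : m0 = atInf K ((ρ ^ 2 - algebraMap K F T * ρ + algebraMap K F E) • m) := by
    have : m0 = spreadMul K ρ m1 + E • m2 := by
      rw [← sub_eq_zero, ← neg_eq_zero, ← hr1]; abel
    rw [this, e1, e2, map_neg, spreadMul_atInf, ← map_smul, ← map_neg, ← map_add,
      ← algebraMap_smul F E m, smul_smul, ← neg_smul, ← add_smul]
    congr 2; ring
  have hceq : c = cubicOf T E N ρ (c 0) m := by
    funext i
    fin_cases i
    · rfl
    · change c 1 = T • c 0 + atInf K m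
      rw [← e2, hm2]; abel
    · change c 2 = E • c 0 + atInf K _
      rw [← neg_eq_iff_eq_neg.2 e1, hm1]; abel
    · change c 3 = N • c 0 + atInf K _
      rw [← e0, hm0]; abel
  refine ⟨T, E, N, ρ, c 0, m, hρ, hroot, ?_, ?_, hceq⟩
  · intro hb
    -- If b were at infinity, four independent vectors would lie in a spread element, which has rank
    -- three.
    have hall : ∀ i, c i ∈ spreadElt K L := by
      intro i
      rw [← hinf]
      refine ⟨Submodule.subset_span ⟨i, rfl⟩, ?_⟩
      change (c i).2.2 = 0
      rw [hceq]
      fin_cases i <;> simp [cubicOf, hb]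
    obtain ⟨m', -, hL⟩ := exists_submodule_eq_span hLi
    simp only [mem_spreadElt_iff hL] at hall
    choose a ha using hall
    have : FiniteDimensional K F := Module.finite_of_finrank_pos (by omega)
    have hali : LinearIndependent K a := by
      refine LinearIndependent.of_comp
        ((atInf K).comp ((LinearMap.toSpanSingleton F (F × F) m').restrictScalars K)) ?_
      convert hli using 1
      funext i
      rw [ha i]; rfl
    have := hali.fintype_card_le_finrank
    rw [hF] at this
    simp at this
  · intro h0
    have h1 : c 1 - T • c 0 = 0 := by rw [← hm2, e2, h0, map_zero]
    have := Fintype.linearIndependent_iff.1 hli ![-T, 1, 0, 0]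
      (by simp [Fin.sum_univ_four]; rw [← h1]; abel) 1
    simp at this

end SpecialCurves

/-! ### Sublines in affine coordinates and their tangent traces -/

section Sublines

variable {K F : Type*} [Field K] [Field F] [Algebra K F]

/-- The affine vector with coordinates `e`. -/
def aff (K : Type*) {F : Type*} [Field K] (e : F × F) : Vec K F := (e.1, e.2, 1)

/-- The point with parameter `(s, t)` of an affine subline of order `q`. -/
noncomputable def subPt (b m : F × F) (ρ : F) (s t : K) : F × F :=
  b + (algebraMap K F t / linForm ρ s t) • m

theorem aff_ne_zero {K F : Type*} [Field K] [Field F] (e : F × F) : aff K e ≠ 0 := fun h => by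
  simpa [aff] using congrArg (fun v : Vec K F => v.2.2) h

theorem aff_add_atInf (e m : F × F) : aff K e + atInf K m = aff K (e + m) := by
  apply vec_ext <;> simp [aff]

theorem smul_aff_eq {b : Vec K F} (hb : b.2.2 ≠ 0) :
    b = b.2.2 • aff K (b.2.2⁻¹ • (b.1, b.2.1)) := by
  apply vec_ext <;> simp [aff, hb]

theorem span_aff_inj {e e' : F × F}
    (h : Submodule.span K {aff K e} = Submodule.span K {aff K e'}) : e = e' := by
  have : aff K e ∈ Submodule.span K {aff K e'} := h ▸ Submodule.mem_span_singleton_self _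
  obtain ⟨k, hk⟩ := Submodule.mem_span_singleton.1 this
  have hk1 : k = 1 := by simpa [aff] using congrArg (fun v : Vec K F => v.2.2) hk
  subst hk1
  rw [one_smul] at hk
  exact Prod.ext (congrArg (fun v : Vec K F => v.1) hk).symm
    (congrArg (fun v : Vec K F => v.2.1) hk).symm

theorem span_singleton_smul {V : Type*} [AddCommGroup V] [Module K V] {k : K} (hk : k ≠ 0)
    (v : V) : Submodule.span K {k • v} = Submodule.span K {v} :=
  Submodule.span_singleton_smul_eq (IsUnit.mk0 k hk) v

theorem exists_complement {s t : K} (h : (s, t) ≠ 0) : ∃ s' t' : K, s * t' - t * s' = 1 := by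
  by_cases hs : s = 0
  · have ht : t ≠ 0 := fun ht => h (by rw [hs, ht]; rfl)
    exact ⟨-t⁻¹, 0, by simp [ht]⟩
  · exact ⟨0, s⁻¹, by simp [hs]⟩

theorem subPt_sub {ρ : F} (hρ : ρ ∉ Set.range (algebraMap K F)) (b m : F × F) {s t s' t' : K}
    (h : (s, t) ≠ 0) (h' : (s', t') ≠ 0) :
    subPt b m ρ s' t' - subPt b m ρ s t =
      (algebraMap K F (s * t' - t * s') / (linForm ρ s t * linForm ρ s' t')) • m := by
  have h1 := linForm_ne_zero hρ h
  have h2 := linForm_ne_zero hρ h'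
  rw [subPt, subPt, add_sub_add_left_eq_sub, ← sub_smul]
  congr 1
  field_simp
  simp only [linForm, map_sub, map_mul]
  ring

/-- Independence of the tangent direction from the parametrisation. By `subPt_sub`, each difference
from the common point compares m with m'. One further point gives the ratio of the two tangent
vectors as an element of F; a second one, with a suitably shifted parameter, forces that ratio into
K. -/
theorem exists_smul_eq_of_subPt_eq {ρ ρ' : F} (hρ : ρ ∉ Set.range (algebraMap K F))
    (hρ' : ρ' ∉ Set.range (algebraMap K F)) {b m b' m' : F × F} (hm : m ≠ 0) (hm' : m' ≠ 0)
    (hsub : ∀ s t : K, (s, t) ≠ 0 → ∃ s' t' : K, (s', t') ≠ 0 ∧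
      subPt b m ρ s t = subPt b' m' ρ' s' t')
    {s t s' t' : K} (h : (s, t) ≠ 0) (h' : (s', t') ≠ 0)
    (he : subPt b m ρ s t = subPt b' m' ρ' s' t') :
    ∃ k : K, k ≠ 0 ∧ (1 / linForm ρ' s' t' ^ 2) • m' = k • (1 / linForm ρ s t ^ 2) • m := by
  obtain ⟨s1, t1, h1⟩ := exists_complement h
  obtain ⟨p, r, hpr⟩ := exists_complement h'
  have hl := linForm_ne_zero hρ h
  have hl' := linForm_ne_zero hρ' h'
  -- a point of the first subline determines a rational translate of a fixed element
  have key : ∀ s2 t2 : K, s * t2 - t * s2 = 1 → ∃ a : K,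
      (1 / linForm ρ' s' t' ^ 2) • m' =
        ((linForm ρ' p r / linForm ρ' s' t' + algebraMap K F a) *
          (linForm ρ s t / linForm ρ s2 t2)) • (1 / linForm ρ s t ^ 2) • m := by
    intro s2 t2 h2
    have h2' : (s2, t2) ≠ 0 := by
      intro h0
      obtain ⟨rfl, rfl⟩ := Prod.mk.inj h0
      simp at h2
    obtain ⟨x, y, hxy, e⟩ := hsub s2 t2 h2'
    have d := congrArg₂ (· - ·) e he
    simp only [subPt_sub hρ b m h h2', subPt_sub hρ' b' m' h' hxy, h2, map_one] at d
    have hl2 := linForm_ne_zero hρ h2'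
    have hlx := linForm_ne_zero hρ' hxy
    set δ := s' * y - t' * x with hδ
    have hδ0 : δ ≠ 0 := by
      intro h0
      rw [h0, map_zero, zero_div, zero_smul] at d
      exact smul_ne_zero (div_ne_zero one_ne_zero (mul_ne_zero hl hl2)) hm d
    have hδF : algebraMap K F δ ≠ 0 := by simpa using hδ0
    refine ⟨(x * r - y * p) / δ, ?_⟩
    have hx : linForm ρ' x y = algebraMap K F δ * linForm ρ' p r +
        algebraMap K F (x * r - y * p) * linForm ρ' s' t' := by
      have e1 : x = δ * p + (x * r - y * p) * s' := by
        rw [hδ]; linear_combination -x * hpr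
      have e2 : y = δ * r + (x * r - y * p) * t' := by
        rw [hδ]; linear_combination -y * hpr
      have e1' := congrArg (algebraMap K F) e1
      have e2' := congrArg (algebraMap K F) e2
      simp only [linForm, map_add, map_mul, map_sub] at e1' e2' ⊢
      linear_combination e1' + ρ' * e2'
    have hcoef : linForm ρ' p r / linForm ρ' s' t' + algebraMap K F ((x * r - y * p) / δ) =
        linForm ρ' x y / (algebraMap K F δ * linForm ρ' s' t') := by
      rw [hx, map_div₀]; field_simp
    rw [hcoef]
    calc (1 / linForm ρ' s' t' ^ 2) • m'
        = (linForm ρ' x y / (algebraMap K F δ * linForm ρ' s' t')) •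
          (algebraMap K F δ / (linForm ρ' s' t' * linForm ρ' x y)) • m' := by
          rw [smul_smul]; congr 1; field_simp
      _ = _ := by
          rw [← d, smul_smul, smul_smul]; congr 1; field_simp
  obtain ⟨a, ha⟩ := key s1 t1 h1
  -- Adding (s, t) keeps the determinant equal to 1 and adds λ = `linForm ρ s t` to the old value g
  -- of the form.
  obtain ⟨a', ha'⟩ := key (s1 + s) (t1 + t) (by linear_combination h1)
  have hn : (1 / linForm ρ s t ^ 2) • m ≠ 0 :=
    smul_ne_zero (div_ne_zero one_ne_zero (pow_ne_zero 2 hl)) hm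
  have heq := smul_left_injective F hn (ha.symm.trans ha')
  have g1 : linForm ρ s1 t1 ≠ 0 := linForm_ne_zero hρ (by
    intro h0; obtain ⟨rfl, rfl⟩ := Prod.mk.inj h0; simp at h1)
  have hsum : linForm ρ (s1 + s) (t1 + t) = linForm ρ s1 t1 + linForm ρ s t := by
    simp only [linForm, map_add]; ring
  have g2 : linForm ρ s1 t1 + linForm ρ s t ≠ 0 := by
    rw [← hsum]
    refine linForm_ne_zero hρ ?_
    intro h0
    obtain ⟨e1, e2⟩ := Prod.mk.inj h0
    rw [eq_neg_of_add_eq_zero_left e1, eq_neg_of_add_eq_zero_left e2] at h1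
    ring_nf at h1
    simp at h1
  rw [hsum] at heq
  -- Call the ratio κ and the fixed quotient c₀. The two expressions say c₀ + a = κg/λ and c₀ + a' =
  -- κ(g/λ + 1); subtracting, κ = a' - a.
  have hk : (linForm ρ' p r / linForm ρ' s' t' + algebraMap K F a) *
      (linForm ρ s t / linForm ρ s1 t1) = algebraMap K F (a' - a) := by
    set P := linForm ρ' p r / linForm ρ' s' t'
    rw [map_sub]
    field_simp at heq ⊢
    linear_combination heq
  rw [hk, algebraMap_smul] at ha
  refine ⟨a' - a, ?_, ha⟩
  intro h0
  rw [h0, zero_smul] at ha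
  exact smul_ne_zero (div_ne_zero one_ne_zero (pow_ne_zero 2 hl')) hm' ha

theorem cubicVec_cubicOf_eq_aff {T E N : K} {ρ : F} (hρ : ρ ∉ Set.range (algebraMap K F))
    (hc : IsCubicRoot T E N ρ) {b : Vec K F} (hb : b.2.2 ≠ 0) (m : F × F) {s t : K}
    (h : (s, t) ≠ 0) :
    cubicVec (cubicOf T E N ρ b m) s t = (normForm T E N s t * b.2.2) •
      aff K (subPt (b.2.2⁻¹ • (b.1, b.2.1)) (b.2.2⁻¹ • m) ρ s t) := by
  rw [cubicVec_cubicOf hρ hc b m h, mul_smul, subPt, ← aff_add_atInf, smul_add b.2.2,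
    ← smul_aff_eq hb, smul_comm _ b.2.2⁻¹ m, map_smul (atInf K) b.2.2⁻¹, smul_smul, mul_inv_cancel₀ hb, one_smul]

theorem cubicTangent_cubicOf_inf (hF : Module.finrank K F = 3) {T E N : K} {ρ : F}
    (hρ : ρ ∉ Set.range (algebraMap K F)) (hc : IsCubicRoot T E N ρ) {b : Vec K F}
    (hb : b.2.2 ≠ 0) (m : F × F) {s t : K} (h : (s, t) ≠ 0) :
    cubicTangent (cubicOf T E N ρ b m) s t ⊓ hypInfty K F =
      Submodule.span K {atInf K ((1 / linForm ρ s t ^ 2) • m)} := by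
  rw [cubicTangent_cubicOf hF hρ hc b m h]
  exact span_pair_inf_hypInfty (by simpa using hb) rfl

/-- Any special cubic carrying the subline is put into normal form and compared with the given
parametrisation; for the converse, that parametrisation itself comes from a special cubic. -/
theorem isTangentTrace_iff (hF : Module.finrank K F = 3) {ρ : F}
    (hρ : ρ ∉ Set.range (algebraMap K F)) {b m : F × F} (hm : m ≠ 0) {l : Set (PG2 F)}
    (hl : affineImage K l = {X | ∃ s t : K, (s, t) ≠ 0 ∧
      X.submodule = Submodule.span K {aff K (subPt b m ρ s t)}})
    {P : PG2 F} {s t : K} (hst : (s, t) ≠ 0)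
    (hP : (sigma K P).submodule = Submodule.span K {aff K (subPt b m ρ s t)}) {I : PG6 K F} :
    IsTangentTrace P l I ↔
      I.submodule = Submodule.span K {atInf K ((1 / linForm ρ s t ^ 2) • m)} := by
  constructor
  · rintro ⟨c, L, s', t', hL, hc, hcl, hst', hP', hI⟩
    obtain ⟨T, E, N, σ, b', m', hσ, hroot, hb', hm', rfl⟩ := exists_eq_cubicOf hF hL hc
    have hpt : ∀ s t : K, (s, t) ≠ 0 →
        Submodule.span K {cubicVec (cubicOf T E N σ b' m') s t} = Submodule.span K
          {aff K (subPt (b'.2.2⁻¹ • (b'.1, b'.2.1)) (b'.2.2⁻¹ • m') σ s t)} := by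
      intro s t h
      rw [cubicVec_cubicOf_eq_aff hσ hroot hb' m' h, span_singleton_smul
        (mul_ne_zero (normForm_ne_zero hF hσ hroot h) hb')]
    obtain ⟨k, hk, e⟩ := exists_smul_eq_of_subPt_eq hσ hρ
      (smul_ne_zero (inv_ne_zero hb') hm') hm (by
        intro s t h
        set X : PG6 K F := Projectivization.mk K (cubicVec (cubicOf T E N σ b' m') s t)
          (cubicVec_ne_zero hc.1 h) with hX
        have : X ∈ affineImage K l := by
          rw [← hcl]
          exact ⟨s, t, h, Projectivization.submodule_mk _ _⟩
        rw [hl] at this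
        obtain ⟨x, y, hxy, e⟩ := this
        refine ⟨x, y, hxy, span_aff_inj (K := K) ?_⟩
        rw [← hpt s t h, ← e, hX, Projectivization.submodule_mk]) hst' hst
      (span_aff_inj (K := K) (by rw [← hpt s' t' hst', ← hP', hP]))
    rw [← hI, cubicTangent_cubicOf_inf hF hσ hroot hb' m' hst', e, smul_comm _ b'.2.2⁻¹ m',
      map_smul (atInf K) k, map_smul (atInf K) b'.2.2⁻¹, smul_smul, span_singleton_smul (mul_ne_zero hk (inv_ne_zero hb'))]
  · intro hI
    obtain ⟨T, E, N, hroot⟩ := exists_isCubicRoot hF hρ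
    have hv : (![m.1, m.2, 0] : Fin 3 → F) ≠ 0 := by
      intro h0
      exact hm (Prod.ext (congrFun h0 0) (congrFun h0 1))
    have hL : (Projectivization.mk F _ hv).submodule = Submodule.span F {![m.1, m.2, 0]} :=
      Projectivization.submodule_mk _ _
    have hb : (aff K b).2.2 ≠ 0 := one_ne_zero
    have hpt : ∀ s t : K, (s, t) ≠ 0 →
        Submodule.span K {cubicVec (cubicOf T E N ρ (aff K b) m) s t} = Submodule.span K
          {aff K (subPt b m ρ s t)} := by
      intro s t h
      rw [cubicVec_cubicOf_eq_aff hρ hroot hb m h, span_singleton_smul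
        (mul_ne_zero (normForm_ne_zero hF hρ hroot h) hb)]
      simp [aff]
    refine ⟨cubicOf T E N ρ (aff K b) m, _, s, t, ?_, isSpecialCubic_cubicOf hF hρ hroot hb hm hL,
      ?_, hst, ?_, ?_⟩
    · rw [hL, Submodule.span_singleton_le_iff_mem]
      simp [lineInfty]
    · rw [hl]
      ext X
      constructor
      · rintro ⟨x, y, hxy, e⟩
        exact ⟨x, y, hxy, by rw [e, hpt x y hxy]⟩
      · rintro ⟨x, y, hxy, e⟩
        exact ⟨x, y, hxy, by rw [e, hpt x y hxy]⟩
    · rw [hP, hpt s t hst]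
    · rw [cubicTangent_cubicOf_inf hF hρ hroot hb m hst, hI]

end Sublines

/-! ### Coordinates adapted to a tangent subplane -/

/-- Data describing a subplane that is tangent to the line at infinity: its points are
`(a t + (b + c τ) u + c w, b + c τ)` with `a, b, c` in `K`. -/
structure Frame (K F : Type*) [Field K] [Field F] [Algebra K F] where
  τ : F
  t : F × F
  u : F × F
  w : F × F
  not_mem : τ ∉ Set.range (algebraMap K F)
  indep : ∀ α β : F, α • t + β • w = 0 → α = 0 ∧ β = 0

namespace Frame

variable {K F : Type*} [Field K] [Field F] [Algebra K F] (f : Frame K F)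

/-- The homography that maps the canonical subplane to the one described by the frame. -/
def lin : (Fin 3 → F) →ₗ[F] (Fin 3 → F) where
  toFun y := ![y 0 * f.t.1 + (y 1 + y 2 * f.τ) * f.u.1 + y 2 * f.w.1,
    y 0 * f.t.2 + (y 1 + y 2 * f.τ) * f.u.2 + y 2 * f.w.2, y 1 + y 2 * f.τ]
  map_add' x y := by ext i; fin_cases i <;> simp <;> ring
  map_smul' k y := by ext i; fin_cases i <;> simp <;> ring

theorem lin_apply (y : Fin 3 → F) :
    f.lin y = ![y 0 * f.t.1 + (y 1 + y 2 * f.τ) * f.u.1 + y 2 * f.w.1,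
    y 0 * f.t.2 + (y 1 + y 2 * f.τ) * f.u.2 + y 2 * f.w.2, y 1 + y 2 * f.τ] := rfl

theorem lin_injective : Function.Injective f.lin := by
  rw [← LinearMap.ker_eq_bot, LinearMap.ker_eq_bot']
  intro y hy
  have h2 : y 1 + y 2 * f.τ = 0 := by simpa [lin_apply] using congrFun hy 2
  have h0 := congrFun hy 0
  have h1 := congrFun hy 1
  simp only [lin_apply, h2, Matrix.cons_val_zero, Matrix.cons_val_one, zero_mul, add_zero,
    Pi.zero_apply] at h0 h1
  obtain ⟨e0, e2⟩ := f.indep (y 0) (y 2) (Prod.ext h0 h1)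
  have e1 : y 1 = 0 := by simpa [e2] using h2
  ext i; fin_cases i <;> assumption

/-- Coordinates in `F` of a point with coordinates in `K`. -/
def hat (F : Type*) [Field F] [Algebra K F] (a b c : K) : Fin 3 → F :=
  ![algebraMap K F a, algebraMap K F b, algebraMap K F c]

/-- The coordinate vectors of the points of the subplane. -/
def vec (a b c : K) : Fin 3 → F := f.lin (hat F a b c)

theorem vec_ne_zero {a b c : K} (h : (a, b, c) ≠ 0) : f.vec a b c ≠ 0 := by
  intro h0
  have := f.lin_injective (h0.trans (map_zero f.lin).symm)
  apply h
  have h0 := congrFun this 0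
  have h1 := congrFun this 1
  have h2 := congrFun this 2
  simp only [hat, Matrix.cons_val_zero, Matrix.cons_val_one, Matrix.cons_val, Pi.zero_apply,
    map_eq_zero] at h0 h1 h2
  rw [h0, h1, h2]; rfl

/-- The subplane described by the frame. -/
def plane : Set (PG2 F) :=
  {P | ∃ a b c : K, (a, b, c) ≠ 0 ∧ P.submodule = Submodule.span F {f.vec a b c}}

/-- A rational basis starting with a vector x0 for T is chosen, and the homography is rescaled so
that the images of x0, x1, x2 have last coordinates 0, 1, τ. That T is the only point at infinity
means τ is not in K. -/
theorem exists_frame {B : Set (PG2 F)} {T : PG2 F} (hB : IsTangentSubplane K B T) :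
    ∃ f : Frame K F, B = f.plane ∧ T.submodule = Submodule.span F {f.vec 1 0 0} := by
  obtain ⟨⟨g, hg⟩, hT⟩ := hB
  have hTB : T ∈ B ∧ T.submodule ≤ lineInfty F := by
    have : T ∈ {P | P ∈ B ∧ P.submodule ≤ lineInfty F} := by rw [hT]; rfl
    exact this
  let e : (Fin 3 → K) → (Fin 3 → F) := fun x i => algebraMap K F (x i)
  have he_add : ∀ x y, e (x + y) = e x + e y := fun x y => by ext i; simp [e]
  have he_smul : ∀ (k : K) x, e (k • x) = algebraMap K F k • e x := fun k x => by
    ext i; simp [e]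
  have he_ne : ∀ x, x ≠ 0 → e x ≠ 0 := by
    intro x hx h0
    apply hx
    ext i
    simpa [e] using congrFun h0 i
  obtain ⟨x0, hx0, hTx⟩ : ∃ x : Fin 3 → K, x ≠ 0 ∧ T.submodule = Submodule.span F {g (e x)} := by
    have := hTB.1
    rw [hg] at this
    exact this
  -- The tangency hypothesis in vector form; the proportionality factor is in K because some
  -- coordinate of x0 is nonzero.
  have hinf : ∀ x : Fin 3 → K, g (e x) 2 = 0 → ∃ k : K, x = k • x0 := by
    intro x hx
    by_cases hx' : x = 0
    · exact ⟨0, by simp [hx']⟩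
    have hne : g (e x) ≠ 0 := by simpa using he_ne x hx'
    have hmem : Projectivization.mk F _ hne ∈ {P | P ∈ B ∧ P.submodule ≤ lineInfty F} := by
      refine ⟨?_, ?_⟩
      · rw [hg]; exact ⟨x, hx', Projectivization.submodule_mk _ _⟩
      · rw [Projectivization.submodule_mk, Submodule.span_singleton_le_iff_mem]
        exact hx
    rw [hT, Set.mem_singleton_iff] at hmem
    have h1 : g (e x) ∈ Submodule.span F {g (e x0)} := by
      rw [← hTx, ← hmem, Projectivization.submodule_mk]
      exact Submodule.mem_span_singleton_self _
    obtain ⟨c, hc⟩ := Submodule.mem_span_singleton.1 h1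
    rw [← map_smul] at hc
    have hc := g.injective hc
    obtain ⟨i, hi⟩ := Function.ne_iff.1 hx0
    have hi : x0 i ≠ 0 := hi
    have hiF : algebraMap K F (x0 i) ≠ 0 := by simpa using hi
    have hck : c = algebraMap K F (x i / x0 i) := by
      rw [map_div₀, eq_div_iff hiF]
      exact congrFun hc i
    refine ⟨x i / x0 i, ?_⟩
    ext j
    apply (algebraMap K F).injective
    have := congrFun hc j
    rw [hck] at this
    simpa [e] using this.symm
  have hli1 : LinearIndependent K ![x0] := by simpa using hx0
  obtain ⟨x1, hli2⟩ := exists_linearIndependent_snoc_of_lt_finrank hli1 (by simp)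
  obtain ⟨x2, hli3⟩ := exists_linearIndependent_snoc_of_lt_finrank hli2 (by simp)
  set v : Fin 3 → Fin 3 → K := ![x0, x1, x2] with hv
  have hliv : LinearIndependent K v := by
    have : v = Fin.snoc (Fin.snoc ![x0] x1) x2 := by
      funext i; fin_cases i <;> rfl
    rw [this]
    exact hli3
  have h3 : ∀ a b c : K, a • x0 + b • x1 + c • x2 = 0 → a = 0 ∧ b = 0 ∧ c = 0 := by
    intro a b c h
    have := Fintype.linearIndependent_iff.1 hliv ![a, b, c] (by
      simpa [Fin.sum_univ_three, hv] using h)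
    exact ⟨this 0, this 1, this 2⟩
  have hspan : ∀ x : Fin 3 → K, ∃ a b c : K, x = a • x0 + b • x1 + c • x2 := by
    intro x
    have := hliv.span_eq_top_of_card_eq_finrank' (by simp)
    have hx : x ∈ Submodule.span K (Set.range v) := this ▸ Submodule.mem_top
    obtain ⟨c, hc⟩ := (Submodule.mem_span_range_iff_exists_fun K).1 hx
    exact ⟨c 0, c 1, c 2, by simpa [Fin.sum_univ_three, hv] using hc.symm⟩
  -- Independence passes from K to F because an invertible matrix stays invertible after extension
  -- of scalars.
  have hF3 : ∀ a b c : F, a • e x0 + b • e x1 + c • e x2 = 0 → a = 0 ∧ b = 0 ∧ c = 0 := by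
    intro a b c h
    have hu : IsUnit (Matrix.of v) := Matrix.linearIndependent_rows_iff_isUnit.1 hliv
    have hu' := hu.map (RingHom.mapMatrix (m := Fin 3) (algebraMap K F))
    have hl := Matrix.linearIndependent_rows_iff_isUnit.2 hu'
    have := Fintype.linearIndependent_iff.1 hl ![a, b, c] (by
      rw [← h]
      ext i
      simp [Fin.sum_univ_three, hv, e])
    exact ⟨this 0, this 1, this 2⟩
  set z1 := g (e x1) 2 with hz1
  set z2 := g (e x2) 2 with hz2
  have hz0 : g (e x0) 2 = 0 := by
    have : g (e x0) ∈ lineInfty F := hTB.2 (by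
      rw [hTx]; exact Submodule.mem_span_singleton_self _)
    exact this
  have hz1ne : z1 ≠ 0 := by
    intro h
    obtain ⟨k, hk⟩ := hinf x1 h
    have := h3 (-k) 1 0 (by rw [hk]; simp)
    exact one_ne_zero this.2.1
  have hgsum : ∀ a b c : F, g (a • e x0 + b • e x1 + c • e x2) =
      a • g (e x0) + b • g (e x1) + c • g (e x2) := by
    intro a b c; simp
  let f : Frame K F :=
    { τ := z2 / z1
      t := (z1⁻¹ * g (e x0) 0, z1⁻¹ * g (e x0) 1)
      u := (z1⁻¹ * g (e x1) 0, z1⁻¹ * g (e x1) 1)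
      w := (z1⁻¹ * g (e x2) 0 - z2 / z1 * (z1⁻¹ * g (e x1) 0),
        z1⁻¹ * g (e x2) 1 - z2 / z1 * (z1⁻¹ * g (e x1) 1))
      not_mem := by
        -- With τ = k in K the rational vector x2 - k x1 would be at infinity, hence a multiple of
        -- x0.
        rintro ⟨k, hk⟩
        obtain ⟨j, hj⟩ := hinf (x2 - k • x1) (by
          have : e (x2 - k • x1) = (0 : F) • e x0 + (-algebraMap K F k) • e x1 +
              (1 : F) • e x2 := by
            ext i; simp [e, Algebra.smul_def]; ring
          rw [this, hgsum, hk]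
          simp only [Pi.add_apply, Pi.smul_apply, smul_eq_mul, ← hz1, ← hz2]
          field_simp
          ring)
        have := h3 (-j) (-k) 1 (by rw [neg_smul, ← hj]; module)
        exact one_ne_zero this.2.2
      indep := by
        intro α β h
        have h0 := congrArg Prod.fst h
        have h1 := congrArg Prod.snd h
        simp only [Prod.fst_add, Prod.snd_add, Prod.smul_fst, Prod.smul_snd, smul_eq_mul,
          Prod.fst_zero, Prod.snd_zero] at h0 h1
        -- The coefficient of x1 makes the last coordinate vanish; the other two coordinates are the
        -- given relation times z1.
        have hz : g (α • e x0 + (-(β * (z2 / z1))) • e x1 + β • e x2) = 0 := by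
          rw [hgsum]
          ext i
          fin_cases i
          · simp only [Pi.add_apply, Pi.smul_apply, smul_eq_mul, Pi.zero_apply, Fin.zero_eta]
            field_simp at h0 ⊢
            linear_combination h0
          · simp only [Pi.add_apply, Pi.smul_apply, smul_eq_mul, Pi.zero_apply, Fin.mk_one]
            field_simp at h1 ⊢
            linear_combination h1
          · change α * g (e x0) 2 + -(β * (z2 / z1)) * z1 + β * z2 = 0
            rw [hz0]
            field_simp
            ring
        rw [map_eq_zero_iff _ g.injective] at hz
        obtain ⟨ha, -, hb⟩ := hF3 _ _ _ hz
        exact ⟨ha, hb⟩ }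
  have hvec : ∀ a b c : K, f.vec a b c = z1⁻¹ • g (e (a • x0 + b • x1 + c • x2)) := by
    intro a b c
    rw [he_add, he_add, he_smul, he_smul, he_smul, hgsum]
    ext i
    fin_cases i
    · simp [vec, lin_apply, hat, f, Algebra.smul_def]
      field_simp
      ring
    · simp [vec, lin_apply, hat, f, Algebra.smul_def]
      field_simp
      ring
    · simp [vec, lin_apply, hat, f, hz0, ← hz1, ← hz2, Algebra.smul_def]
      field_simp
  have hspanvec : ∀ a b c : K, Submodule.span F {f.vec a b c} =
      Submodule.span F {g (e (a • x0 + b • x1 + c • x2))} := by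
    intro a b c
    rw [hvec, span_singleton_smul (inv_ne_zero hz1ne)]
  refine ⟨f, ?_, ?_⟩
  · rw [hg]
    ext P
    constructor
    · rintro ⟨x, hx, hP⟩
      obtain ⟨a, b, c, rfl⟩ := hspan x
      refine ⟨a, b, c, ?_, by rw [hspanvec]; exact hP⟩
      rintro h
      simp only [Prod.mk_eq_zero] at h
      exact hx (by rw [h.1, h.2.1, h.2.2]; simp)
    · rintro ⟨a, b, c, h, hP⟩
      refine ⟨a • x0 + b • x1 + c • x2, ?_, by rw [hP, hspanvec]⟩
      intro h0
      obtain ⟨rfl, rfl, rfl⟩ := h3 _ _ _ h0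
      exact h rfl
  · rw [hTx, hspanvec]
    simp

end Frame

/-! ### Lines of the plane spanned by two points -/

section

variable {F : Type*} [Field F]

theorem submodule_sup_eq {P Q : PG2 F} (hPQ : P ≠ Q) {W : Submodule F (Fin 3 → F)}
    (hP : P.submodule ≤ W) (hQ : Q.submodule ≤ W) (hW : Module.finrank F W = 2) :
    P.submodule ⊔ Q.submodule = W := by
  have hlt : P.submodule < P.submodule ⊔ Q.submodule := by
    refine lt_of_le_of_ne le_sup_left fun h => hPQ ?_
    have hle : Q.submodule ≤ P.submodule := by rw [h]; exact le_sup_right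
    exact (Projectivization.submodule_injective
      (Submodule.eq_of_le_of_finrank_eq hle (by
        rw [Projectivization.finrank_submodule, Projectivization.finrank_submodule]))).symm
  have := Submodule.finrank_lt_finrank_of_lt hlt
  rw [Projectivization.finrank_submodule] at this
  exact Submodule.eq_of_le_of_finrank_le (sup_le hP hQ) (by omega)

theorem extLine_eq {l : Set (PG2 F)} (hl : l.Nontrivial) {W : Submodule F (Fin 3 → F)}
    (hW : Module.finrank F W = 2) (h : ∀ P ∈ l, P.submodule ≤ W) : extLine l = W := by
  obtain ⟨P, hP, Q, hQ, hPQ⟩ := hl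
  apply le_antisymm
  · exact iSup₂_le h
  · rw [← submodule_sup_eq hPQ (h P hP) (h Q hQ) hW]
    exact sup_le (le_iSup₂_of_le P hP le_rfl) (le_iSup₂_of_le Q hQ le_rfl)

end

/-! ### Points, lines and affine coordinates of the framed subplane -/

namespace Frame

variable {K F : Type*} [Field K] [Field F] [Algebra K F] (f : Frame K F)

theorem vec_smul (k a b c : K) :
    f.vec (k * a) (k * b) (k * c) = algebraMap K F k • f.vec a b c := by
  rw [vec, vec, ← map_smul]
  congr 1
  ext i; fin_cases i <;> simp [hat]

theorem exists_of_span_vec_eq {a b c a' b' c' : K} (h : (a, b, c) ≠ 0)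
    (e : Submodule.span F {f.vec a b c} = Submodule.span F {f.vec a' b' c'}) :
    ∃ k : K, a' = k * a ∧ b' = k * b ∧ c' = k * c := by
  have : f.vec a' b' c' ∈ Submodule.span F {f.vec a b c} :=
    e ▸ Submodule.mem_span_singleton_self _
  obtain ⟨μ, hμ⟩ := Submodule.mem_span_singleton.1 this
  rw [vec, vec, ← map_smul] at hμ
  have hμ := f.lin_injective hμ
  have h0 : μ * algebraMap K F a = algebraMap K F a' := congrFun hμ 0
  have h1 : μ * algebraMap K F b = algebraMap K F b' := congrFun hμ 1
  have h2 : μ * algebraMap K F c = algebraMap K F c' := congrFun hμ 2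
  obtain ⟨k, rfl⟩ : ∃ k, μ = algebraMap K F k := by
    by_cases ha : a = 0
    · by_cases hb : b = 0
      · have hc : c ≠ 0 := fun hc => h (by rw [ha, hb, hc]; rfl)
        exact ⟨c' / c, by rw [map_div₀, eq_div_iff (by simpa using hc), h2]⟩
      · exact ⟨b' / b, by rw [map_div₀, eq_div_iff (by simpa using hb), h1]⟩
    · exact ⟨a' / a, by rw [map_div₀, eq_div_iff (by simpa using ha), h0]⟩
  simp only [← map_mul, (algebraMap K F).injective.eq_iff] at h0 h1 h2
  exact ⟨k, h0.symm, h1.symm, h2.symm⟩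

/-- The point of the subplane with the given coordinates. -/
def pt {a b c : K} (h : (a, b, c) ≠ 0) : PG2 F := Projectivization.mk F _ (f.vec_ne_zero h)

theorem submodule_pt {a b c : K} (h : (a, b, c) ≠ 0) :
    (f.pt h).submodule = Submodule.span F {f.vec a b c} := Projectivization.submodule_mk _ _

theorem pt_mem_plane {a b c : K} (h : (a, b, c) ≠ 0) : f.pt h ∈ f.plane :=
  ⟨a, b, c, h, f.submodule_pt h⟩

/-- The linear form with coefficients in `K`. -/
def form (F : Type*) [Field F] [Algebra K F] (l0 l1 l2 : K) : (Fin 3 → F) →ₗ[F] F where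
  toFun y := algebraMap K F l0 * y 0 + algebraMap K F l1 * y 1 + algebraMap K F l2 * y 2
  map_add' x y := by simp; ring
  map_smul' k y := by simp; ring

/-- The line of the plane over `F` with coordinates in `K` with respect to the frame. -/
def lineSpace (l0 l1 l2 : K) : Submodule F (Fin 3 → F) :=
  (LinearMap.ker (form F l0 l1 l2)).map f.lin

theorem lin_mem_lineSpace {l0 l1 l2 : K} {y : Fin 3 → F} : f.lin y ∈ f.lineSpace l0 l1 l2 ↔
    algebraMap K F l0 * y 0 + algebraMap K F l1 * y 1 + algebraMap K F l2 * y 2 = 0 := by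
  rw [lineSpace, Submodule.mem_map]
  constructor
  · rintro ⟨z, hz, e⟩
    rw [← f.lin_injective e]
    exact hz
  · intro h
    exact ⟨y, h, rfl⟩

theorem vec_mem_lineSpace {l0 l1 l2 a b c : K} : f.vec a b c ∈ f.lineSpace l0 l1 l2 ↔
    l0 * a + l1 * b + l2 * c = 0 := by
  rw [vec, lin_mem_lineSpace]
  simp only [hat, Matrix.cons_val_zero, Matrix.cons_val_one, Matrix.cons_val, ← map_mul,
    ← map_add, map_eq_zero]

theorem finrank_lineSpace {l0 l1 l2 : K} (h : (l0, l1, l2) ≠ 0) :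
    Module.finrank F (f.lineSpace l0 l1 l2) = 2 := by
  have hne : form F l0 l1 l2 ≠ 0 := by
    intro h0
    apply h
    have e : ∀ y, form F l0 l1 l2 y = 0 := fun y => by rw [h0]; rfl
    have e0 := e ![1, 0, 0]
    have e1 := e ![0, 1, 0]
    have e2 := e ![0, 0, 1]
    simp [form] at e0 e1 e2
    rw [e0, e1, e2]; rfl
  have := Module.Dual.finrank_ker_add_one_of_ne_zero (K := F) hne
  rw [lineSpace, ← (Submodule.equivMapOfInjective f.lin f.lin_injective _).finrank_eq]
  simp at this
  omega

/-- The line of the subplane with the given line coordinates. -/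
def line (l0 l1 l2 : K) : Set (PG2 F) :=
  {P | P ∈ f.plane ∧ P.submodule ≤ f.lineSpace l0 l1 l2}

theorem mem_line_iff {l0 l1 l2 : K} {P : PG2 F} : P ∈ f.line l0 l1 l2 ↔
    ∃ a b c : K, (a, b, c) ≠ 0 ∧ P.submodule = Submodule.span F {f.vec a b c} ∧
      l0 * a + l1 * b + l2 * c = 0 := by
  constructor
  · rintro ⟨⟨a, b, c, h, e⟩, hP⟩
    rw [e, Submodule.span_singleton_le_iff_mem, vec_mem_lineSpace] at hP
    exact ⟨a, b, c, h, e, hP⟩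
  · rintro ⟨a, b, c, h, e, hP⟩
    refine ⟨⟨a, b, c, h, e⟩, ?_⟩
    rwa [e, Submodule.span_singleton_le_iff_mem, vec_mem_lineSpace]

theorem pt_mem_line {l0 l1 l2 : K} {a b c : K} (h : (a, b, c) ≠ 0) :
    f.pt h ∈ f.line l0 l1 l2 ↔ l0 * a + l1 * b + l2 * c = 0 := by
  rw [line, Set.mem_ofPred_eq, submodule_pt, Submodule.span_singleton_le_iff_mem,
    vec_mem_lineSpace]
  exact ⟨fun h => h.2, fun h' => ⟨f.pt_mem_plane h, h'⟩⟩

theorem line_smul {k : K} (hk : k ≠ 0) (l0 l1 l2 : K) :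
    f.line (k * l0) (k * l1) (k * l2) = f.line l0 l1 l2 := by
  ext P
  simp only [mem_line_iff]
  refine exists_congr fun a => exists_congr fun b => exists_congr fun c => ?_
  rw [show k * l0 * a + k * l1 * b + k * l2 * c = k * (l0 * a + l1 * b + l2 * c) by ring]
  simp [hk]

/-- The line of the subplane joining the point at infinity to `(0, a, b)`. -/
def thru (a b : K) : Set (PG2 F) := f.line 0 b (-a)

/-- The line with equation `x₀ = p x₁ + r x₂` of the subplane. -/
def skew (p r : K) : Set (PG2 F) := f.line 1 (-p) (-r)

theorem pt_ne_pt {a b c a' b' c' : K} (h : (a, b, c) ≠ 0) (h' : (a', b', c') ≠ 0)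
    (hne : ¬ ∃ k : K, a' = k * a ∧ b' = k * b ∧ c' = k * c) : f.pt h ≠ f.pt h' := by
  intro e
  exact hne (f.exists_of_span_vec_eq h (by rw [← submodule_pt _ h, e, submodule_pt]))

theorem nontrivial_thru {a b : K} (h : (a, b) ≠ 0) : (f.thru a b).Nontrivial := by
  have h1 : ((0, a, b) : K × K × K) ≠ 0 := fun e => h (Prod.mk.inj e).2
  have h0 : ((1, 0, 0) : K × K × K) ≠ 0 := by simp
  refine ⟨f.pt h1, (f.pt_mem_line h1).2 (by ring), f.pt h0, (f.pt_mem_line h0).2 (by ring),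
    f.pt_ne_pt _ _ ?_⟩
  rintro ⟨k, h, -⟩
  simp at h

theorem nontrivial_skew (p r : K) : (f.skew p r).Nontrivial := by
  have h0 : ((p, 1, 0) : K × K × K) ≠ 0 := by simp
  have h1 : ((r, 0, 1) : K × K × K) ≠ 0 := by simp
  refine ⟨f.pt h0, (f.pt_mem_line h0).2 (by ring), f.pt h1, (f.pt_mem_line h1).2 (by ring),
    f.pt_ne_pt _ _ ?_⟩
  rintro ⟨k, -, -, h⟩
  simp at h

theorem isLineOf_thru {a b : K} (h : (a, b) ≠ 0) : IsLineOf f.plane (f.thru a b) := by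
  refine ⟨f.nontrivial_thru h, f.lineSpace 0 b (-a), f.finrank_lineSpace ?_, rfl⟩
  intro e
  apply h
  simp only [Prod.mk_eq_zero, neg_eq_zero] at e
  rw [e.2.1, e.2.2]; rfl

theorem isLineOf_skew (p r : K) : IsLineOf f.plane (f.skew p r) :=
  ⟨f.nontrivial_skew p r, f.lineSpace 1 (-p) (-r), f.finrank_lineSpace (by simp), rfl⟩

theorem extLine_thru {a b : K} (h : (a, b) ≠ 0) :
    extLine (f.thru a b) = f.lineSpace 0 b (-a) := by
  refine extLine_eq (f.nontrivial_thru h) (f.finrank_lineSpace ?_) fun P hP => hP.2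
  intro e
  apply h
  simp only [Prod.mk_eq_zero, neg_eq_zero] at e
  rw [e.2.1, e.2.2]; rfl

theorem extLine_skew (p r : K) : extLine (f.skew p r) = f.lineSpace 1 (-p) (-r) :=
  extLine_eq (f.nontrivial_skew p r) (f.finrank_lineSpace (by simp)) fun _ hP => hP.2

/-- Two points of the subplane have rational coordinates, so their line has rational line
coordinates. The first one vanishes exactly when the line passes through (1, 0, 0), the point at
infinity; otherwise it is normalised to 1. -/
theorem isLineOf_iff {l : Set (PG2 F)} : IsLineOf f.plane l ↔
    (∃ a b : K, (a, b) ≠ 0 ∧ l = f.thru a b) ∨ ∃ p r : K, l = f.skew p r := by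
  constructor
  · rintro ⟨⟨P, hP, Q, hQ, hPQ⟩, W, hW, hl⟩
    have hP' := hP
    have hQ' := hQ
    rw [hl] at hP' hQ'
    obtain ⟨⟨a, b, c, h, eP⟩, hPW⟩ := hP'
    obtain ⟨⟨a', b', c', h', eQ⟩, hQW⟩ := hQ'
    -- the cross product gives the coordinates of the line
    have hcross : (b * c' - c * b', c * a' - a * c', a * b' - b * a') ≠ (0, 0, 0) := by
      intro e
      simp only [Prod.mk.injEq] at e
      obtain ⟨e0, e1, e2⟩ := e
      apply hPQ
      apply Projectivization.submodule_injective
      have key : ∀ x : K, ∀ y : K, x ≠ 0 → y * a = x * a' → y * b = x * b' → y * c = x * c' →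
          P.submodule = Q.submodule := by
        intro x y hx ha hb hc
        have hy : y ≠ 0 := by
          rintro rfl
          simp only [zero_mul, zero_eq_mul, hx, false_or] at ha hb hc
          exact h' (by rw [ha, hb, hc]; rfl)
        rw [eP, eQ, ← span_singleton_smul (K := F) (k := algebraMap K F y) (by simpa using hy),
          ← span_singleton_smul (K := F) (k := algebraMap K F x) (by simpa using hx) (f.vec a' b' c'),
          ← vec_smul, ← vec_smul, ha, hb, hc]
      by_cases ha : a = 0
      · by_cases hb : b = 0
        · have hc : c ≠ 0 := fun hc => h (by rw [ha, hb, hc]; rfl)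
          exact key c c' hc (by linear_combination -e1) (by linear_combination e0) (by ring)
        · exact key b b' hb (by linear_combination e2) (by ring) (by linear_combination -e0)
      · exact key a a' ha (by ring) (by linear_combination -e2) (by linear_combination e1)
    set l0 := b * c' - c * b' with hl0
    set l1 := c * a' - a * c' with hl1
    set l2 := a * b' - b * a' with hl2
    have hline : l = f.line l0 l1 l2 := by
      have : W = f.lineSpace l0 l1 l2 := by
        rw [← submodule_sup_eq hPQ hPW hQW hW]
        refine submodule_sup_eq hPQ ?_ ?_ (f.finrank_lineSpace hcross)
        · rw [eP, Submodule.span_singleton_le_iff_mem, vec_mem_lineSpace]; ring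
        · rw [eQ, Submodule.span_singleton_le_iff_mem, vec_mem_lineSpace]; ring
      rw [hl, this]; rfl
    by_cases hz : l0 = 0
    · left
      refine ⟨-l2, l1, ?_, ?_⟩
      · intro e
        simp only [Prod.mk_eq_zero, neg_eq_zero] at e
        exact hcross (by rw [hz, e.1, e.2])
      · rw [hline, hz, thru, neg_neg]
    · right
      refine ⟨-(l1 / l0), -(l2 / l0), ?_⟩
      rw [hline, skew, ← f.line_smul hz 1]
      congr 1 <;> field_simp
  · rintro (⟨a, b, h, rfl⟩ | ⟨p, r, rfl⟩)
    · exact f.isLineOf_thru h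
    · exact f.isLineOf_skew p r

theorem mem_thru_of_infinity {T : PG2 F} (hT : T.submodule = Submodule.span F {f.vec 1 0 0})
    (a b : K) : T ∈ f.thru a b :=
  f.mem_line_iff.2 ⟨1, 0, 0, by simp, hT, by ring⟩

theorem not_mem_skew_of_infinity {T : PG2 F}
    (hT : T.submodule = Submodule.span F {f.vec 1 0 0}) (p r : K) : T ∉ f.skew p r := by
  rintro ⟨-, h⟩
  rw [hT, Submodule.span_singleton_le_iff_mem, vec_mem_lineSpace] at h
  simp at h

/-- The direction of the affine points of the line `skew p r`. -/
def dir (p r : K) : F × F := (algebraMap K F r - algebraMap K F p * f.τ) • f.t + f.w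

theorem dir_ne_zero (p r : K) : f.dir p r ≠ 0 := by
  intro h
  rw [dir, ← one_smul F f.w] at h
  exact one_ne_zero (f.indep _ _ h).2

theorem t_ne_zero : f.t ≠ 0 := by
  intro h
  have := f.indep 1 0 (by simp [h])
  exact one_ne_zero this.1

theorem exists_coords (m : F × F) : ∃ α β : F, m = α • f.t + β • f.w := by
  have hs := LinearMap.injective_iff_surjective.1 f.lin_injective
  obtain ⟨y, hy⟩ := hs ![m.1, m.2, 0]
  have h2 : y 1 + y 2 * f.τ = 0 := by simpa [lin_apply] using congrFun hy 2
  have h0 := congrFun hy 0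
  have h1 := congrFun hy 1
  simp [lin_apply, h2] at h0 h1
  exact ⟨y 0, y 2, Prod.ext h0.symm h1.symm⟩

theorem coords_inj {α β α' β' : F} (h : α • f.t + β • f.w = α' • f.t + β' • f.w) :
    α = α' ∧ β = β' := by
  have := f.indep (α - α') (β - β') (by
    rw [sub_smul, sub_smul, ← sub_eq_zero.2 h]; abel)
  exact ⟨sub_eq_zero.1 this.1, sub_eq_zero.1 this.2⟩

theorem infVec_mem_lineSpace {α β : F} {l0 l1 l2 : K} :
    (![(α • f.t + β • f.w).1, (α • f.t + β • f.w).2, 0] : Fin 3 → F) ∈ f.lineSpace l0 l1 l2 ↔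
      algebraMap K F l0 * α - algebraMap K F l1 * (β * f.τ) + algebraMap K F l2 * β = 0 := by
  have : (![(α • f.t + β • f.w).1, (α • f.t + β • f.w).2, 0] : Fin 3 → F) =
      f.lin ![α, -(β * f.τ), β] := by
    ext i; fin_cases i <;> simp [lin_apply]
  rw [this, lin_mem_lineSpace]
  simp [sub_eq_add_neg]

theorem vec_one_zero_zero : f.vec 1 0 0 = ![f.t.1, f.t.2, 0] := by
  ext i; fin_cases i <;> simp [vec, hat, lin_apply]

theorem span_infVec_smul {α : F} (hα : α ≠ 0) (m : F × F) :
    Submodule.span F {(![(α • m).1, (α • m).2, 0] : Fin 3 → F)} =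
      Submodule.span F {![m.1, m.2, 0]} := by
  rw [← span_singleton_smul (K := F) hα ![m.1, m.2, 0]]
  congr 2
  ext i; fin_cases i <;> simp

theorem le_lineSpace_thru {T : PG2 F} (hT : T.submodule = Submodule.span F {f.vec 1 0 0})
    {L : PG2 F} (hL : L.submodule ≤ lineInfty F) {a b : K} (h : (a, b) ≠ 0) :
    L.submodule ≤ f.lineSpace 0 b (-a) ↔ L = T := by
  obtain ⟨m, hm, e⟩ := exists_submodule_eq_span hL
  obtain ⟨α, β, rfl⟩ := f.exists_coords m
  rw [e, Submodule.span_singleton_le_iff_mem, infVec_mem_lineSpace]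
  constructor
  · intro h0
    -- On the line at infinity the equation of a line through T reduces to (a + bτ)β = 0, which
    -- leaves only the direction t.
    have hβ : linForm f.τ a b * β = 0 := by
      simp only [map_zero, map_neg] at h0
      rw [linForm]
      linear_combination -h0
    have hβ : β = 0 := (mul_eq_zero.1 hβ).resolve_left (linForm_ne_zero f.not_mem h)
    subst hβ
    apply Projectivization.submodule_injective
    have hα : α ≠ 0 := by rintro rfl; simp at hm
    rw [e, hT, vec_one_zero_zero, zero_smul, add_zero, span_infVec_smul hα]
  · rintro rfl
    rw [← infVec_mem_lineSpace, ← Submodule.span_singleton_le_iff_mem, ← e, hT,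
      Submodule.span_singleton_le_iff_mem, vec_mem_lineSpace]
    ring

theorem le_lineSpace_skew {L : PG2 F} (hL : L.submodule ≤ lineInfty F) {p r : K} :
    L.submodule ≤ f.lineSpace 1 (-p) (-r) ↔
      L.submodule = Submodule.span F {![(f.dir p r).1, (f.dir p r).2, 0]} := by
  obtain ⟨m, hm, e⟩ := exists_submodule_eq_span hL
  obtain ⟨α, β, rfl⟩ := f.exists_coords m
  have hdir : (![(f.dir p r).1, (f.dir p r).2, 0] : Fin 3 → F) ∈ f.lineSpace 1 (-p) (-r) := by
    have := (f.infVec_mem_lineSpace (α := algebraMap K F r - algebraMap K F p * f.τ) (β := 1)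
      (l0 := 1) (l1 := -p) (l2 := -r)).2 (by simp)
    rwa [one_smul] at this
  constructor
  · intro h0
    rw [e, Submodule.span_singleton_le_iff_mem, infVec_mem_lineSpace] at h0
    have hα : α = β * (algebraMap K F r - algebraMap K F p * f.τ) := by
      simp only [map_one, map_neg] at h0
      linear_combination h0
    subst hα
    have hβ : β ≠ 0 := by rintro rfl; simp at hm
    rw [e, mul_smul, ← smul_add, span_infVec_smul hβ]; rfl
  · intro h0
    rw [h0, Submodule.span_singleton_le_iff_mem]
    exact hdir

theorem dir_inj {p r p' r' : K}
    (h : Submodule.span F {(![(f.dir p r).1, (f.dir p r).2, 0] : Fin 3 → F)} =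
      Submodule.span F {![(f.dir p' r').1, (f.dir p' r').2, 0]}) : p = p' ∧ r = r' := by
  have : (![(f.dir p r).1, (f.dir p r).2, 0] : Fin 3 → F) ∈
      Submodule.span F {![(f.dir p' r').1, (f.dir p' r').2, 0]} :=
    h ▸ Submodule.mem_span_singleton_self _
  obtain ⟨μ, hμ⟩ := Submodule.mem_span_singleton.1 this
  have e : μ • f.dir p' r' = f.dir p r := Prod.ext (congrFun hμ 0) (congrFun hμ 1)
  rw [dir, dir, smul_add, smul_smul] at e
  rw [← one_smul F (_ + f.w), smul_add, smul_smul] at e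
  obtain ⟨e1, rfl⟩ := f.coords_inj e
  have e2 : linForm f.τ (r' - r) (p - p') = 0 := by
    rw [linForm, map_sub, map_sub]; rw [one_mul] at e1; linear_combination e1
  obtain ⟨h1, h2⟩ := (linForm_eq_zero f.not_mem).1 e2
  exact ⟨sub_eq_zero.1 h2, (sub_eq_zero.1 h1).symm⟩

/-- The affine coordinates of a point of the subplane. -/
noncomputable def affPt (a b c : K) : F × F :=
  f.u + (algebraMap K F a / linForm f.τ b c) • f.t + (algebraMap K F c / linForm f.τ b c) • f.w

theorem le_lineInfty_iff {P : PG2 F} {a b c : K}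
    (hP : P.submodule = Submodule.span F {f.vec a b c}) :
    P.submodule ≤ lineInfty F ↔ (b, c) = 0 := by
  rw [hP, Submodule.span_singleton_le_iff_mem]
  change linForm f.τ b c = 0 ↔ _
  rw [linForm_eq_zero f.not_mem]
  simp

theorem submodule_sigma {P : PG2 F} {a b c : K}
    (hP : P.submodule = Submodule.span F {f.vec a b c}) (h : (b, c) ≠ 0) :
    (sigma K P).submodule = Submodule.span K {aff K (f.affPt a b c)} := by
  have hl := linForm_ne_zero f.not_mem h
  have : P.rep ∈ Submodule.span F {f.vec a b c} := by
    rw [← hP, Projectivization.submodule_eq]; exact Submodule.mem_span_singleton_self _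
  obtain ⟨μ, hμ⟩ := Submodule.mem_span_singleton.1 this
  have hμ0 : μ ≠ 0 := by
    rintro rfl
    rw [zero_smul] at hμ
    exact P.rep_nonzero hμ.symm
  rw [sigma, Projectivization.submodule_mk]
  congr 2
  have h2 : P.rep 2 = μ * linForm f.τ b c := by rw [← hμ]; rfl
  apply vec_ext
  · simp only [h2]
    rw [← hμ]
    simp [aff, affPt, vec, hat, lin_apply]
    rw [← linForm]
    field_simp
    ring
  · simp only [h2]
    rw [← hμ]
    simp [aff, affPt, vec, hat, lin_apply]
    rw [← linForm]
    field_simp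
    ring
  · rfl

theorem affineImage_line {l0 l1 l2 : K} : affineImage K (f.line l0 l1 l2) =
    {X | ∃ a b c : K, (b, c) ≠ 0 ∧ l0 * a + l1 * b + l2 * c = 0 ∧
      X.submodule = Submodule.span K {aff K (f.affPt a b c)}} := by
  ext X
  constructor
  · rintro ⟨P, ⟨hP, hinf⟩, rfl⟩
    obtain ⟨a, b, c, h, e, hl⟩ := f.mem_line_iff.1 hP
    rw [f.le_lineInfty_iff e] at hinf
    exact ⟨a, b, c, hinf, hl, f.submodule_sigma e hinf⟩
  · rintro ⟨a, b, c, h, hl, hX⟩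
    have h' : (a, b, c) ≠ 0 := fun e => h (Prod.mk.inj e).2
    refine ⟨f.pt h', ⟨(f.pt_mem_line h').2 hl, ?_⟩, ?_⟩
    · rwa [f.le_lineInfty_iff (f.submodule_pt h')]
    · apply Projectivization.submodule_injective
      rw [hX, f.submodule_sigma (f.submodule_pt h') h]

theorem line_zero : f.line 0 0 0 = f.plane := by
  ext P
  rw [mem_line_iff]
  simp [plane]

theorem affineImage_plane : affineImage K f.plane =
    {X | ∃ a b c : K, (b, c) ≠ 0 ∧ X.submodule = Submodule.span K {aff K (f.affPt a b c)}} := by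
  rw [← line_zero, affineImage_line]
  simp

/-- With λ = s + tτ one has ps + rt = pλ + (r - pτ)t, so dividing by λ splits off the constant p. -/
theorem affPt_skew (p r : K) {s t : K} (h : (s, t) ≠ 0) :
    f.affPt (p * s + r * t) s t = subPt (f.u + p • f.t) (f.dir p r) f.τ s t := by
  have hl := linForm_ne_zero f.not_mem h
  rw [affPt, subPt, dir, smul_add, smul_smul, add_assoc, add_assoc, ← algebraMap_smul F p f.t,
    ← add_assoc (_ • f.t) (_ • f.t), ← add_smul]
  congr 3
  field_simp
  simp only [linForm, map_add, map_mul]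
  ring

theorem affineImage_skew (p r : K) : affineImage K (f.skew p r) =
    {X | ∃ s t : K, (s, t) ≠ 0 ∧
      X.submodule = Submodule.span K {aff K (subPt (f.u + p • f.t) (f.dir p r) f.τ s t)}} := by
  rw [skew, affineImage_line]
  ext X
  constructor
  · rintro ⟨a, s, t, h, ha, hX⟩
    have : a = p * s + r * t := by linear_combination ha
    subst this
    exact ⟨s, t, h, by rw [hX, f.affPt_skew p r h]⟩
  · rintro ⟨s, t, h, hX⟩
    exact ⟨p * s + r * t, s, t, h, by ring, by rw [hX, f.affPt_skew p r h]⟩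

end Frame

namespace Frame

variable {K F : Type*} [Field K] [Field F] [Algebra K F] (f : Frame K F)

/-! ### Trace lines and trace planes in coordinates -/

/-- The vector at infinity with coordinates `(α, β) / (b + c τ) ^ 2` with respect to `t`, `w`. -/
def scaled (b c : K) : F × F →ₗ[K] Vec K F :=
  (atInf K).comp
    ({ toFun m := ((1 / linForm f.τ b c ^ 2) * m.1) • f.t +
        ((1 / linForm f.τ b c ^ 2) * m.2) • f.w
       map_add' x y := by simp only [Prod.fst_add, Prod.snd_add, mul_add, add_smul]; abel
       map_smul' k x := by
        simp only [Prod.smul_fst, Prod.smul_snd, mul_smul_comm, smul_assoc, smul_add,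
          RingHom.id_apply] } : F × F →ₗ[K] F × F)

theorem scaled_apply (b c : K) (α β : F) : f.scaled b c (α, β) =
    atInf K ((1 / linForm f.τ b c ^ 2 * α) • f.t + (1 / linForm f.τ b c ^ 2 * β) • f.w) := rfl

theorem scaled_injective {b c : K} (h : (b, c) ≠ 0) : Function.Injective (f.scaled b c) := by
  rintro ⟨α, β⟩ ⟨α', β'⟩ e
  rw [scaled_apply, scaled_apply] at e
  obtain ⟨e1, e2⟩ := f.coords_inj (atInf_injective e)
  have hl : 1 / linForm f.τ b c ^ 2 ≠ 0 :=
    div_ne_zero one_ne_zero (pow_ne_zero 2 (linForm_ne_zero f.not_mem h))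
  rw [mul_left_cancel₀ hl e1, mul_left_cancel₀ hl e2]

/-- The number `r - p τ`, the first coordinate of the direction of the line `skew p r`. -/
def slope (p r : K) : F := algebraMap K F r - algebraMap K F p * f.τ

theorem scaled_slope (b c p r : K) :
    f.scaled b c (f.slope p r, 1) = atInf K ((1 / linForm f.τ b c ^ 2) • f.dir p r) := by
  rw [scaled_apply, dir, smul_add, smul_smul, mul_one]; rfl

theorem scaled_linForm {b c : K} (h : (b, c) ≠ 0) :
    f.scaled b c (linForm f.τ b c, 0) = atInf K ((1 / linForm f.τ b c) • f.t) := by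
  have hl := linForm_ne_zero f.not_mem h
  rw [scaled_apply, mul_zero, zero_smul, add_zero]
  congr 2
  field_simp

theorem scaled_mem_spreadElt_infinity {T : PG2 F}
    (hT : T.submodule = Submodule.span F {f.vec 1 0 0}) {b c : K} (h : (b, c) ≠ 0) {α β : F} :
    f.scaled b c (α, β) ∈ spreadElt K T ↔ β = 0 := by
  rw [vec_one_zero_zero] at hT
  rw [mem_spreadElt_iff hT, scaled_apply]
  constructor
  · rintro ⟨a, ha⟩
    have e := atInf_injective ha
    rw [← add_zero (a • f.t), ← zero_smul F f.w] at e
    have := (f.coords_inj e).2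
    simpa [linForm_ne_zero f.not_mem h] using this
  · rintro rfl
    exact ⟨_, by rw [mul_zero, zero_smul, add_zero]⟩

theorem scaled_mem_spreadElt {L : PG2 F} {p r : K}
    (hL : L.submodule = Submodule.span F {![(f.dir p r).1, (f.dir p r).2, 0]}) {b c : K}
    (h : (b, c) ≠ 0) {α β : F} :
    f.scaled b c (α, β) ∈ spreadElt K L ↔ α = β * f.slope p r := by
  rw [mem_spreadElt_iff hL, scaled_apply]
  have hl := linForm_ne_zero f.not_mem h
  constructor
  · rintro ⟨a, ha⟩
    have e := atInf_injective ha
    rw [dir, smul_add, smul_smul] at e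
    obtain ⟨e1, e2⟩ := f.coords_inj e
    rw [← e2] at e1
    change _ = _ * f.slope p r at e1
    field_simp at e1
    exact e1
  · rintro rfl
    refine ⟨1 / linForm f.τ b c ^ 2 * β, ?_⟩
    rw [dir, smul_add, smul_smul, mul_assoc]; rfl

theorem isTangentTrace_skew_iff (hF : Module.finrank K F = 3) {p r b c : K} (h : (b, c) ≠ 0)
    {P : PG2 F} (hP : P.submodule = Submodule.span F {f.vec (p * b + r * c) b c})
    {I : PG6 K F} : IsTangentTrace P (f.skew p r) I ↔
      I.submodule = Submodule.span K {f.scaled b c (f.slope p r, 1)} := by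
  rw [scaled_slope]
  refine isTangentTrace_iff hF f.not_mem (f.dir_ne_zero p r) (f.affineImage_skew p r) h ?_
  rw [f.submodule_sigma hP h, f.affPt_skew p r h]

theorem mem_skew_iff {P : PG2 F} {p r : K} : P ∈ f.skew p r ↔
    ∃ b c : K, (b, c) ≠ 0 ∧ P.submodule = Submodule.span F {f.vec (p * b + r * c) b c} := by
  rw [skew, mem_line_iff]
  constructor
  · rintro ⟨a, b, c, h, e, hl⟩
    have : a = p * b + r * c := by linear_combination hl
    subst this
    refine ⟨b, c, ?_, e⟩
    intro h0
    obtain ⟨rfl, rfl⟩ := Prod.mk.inj h0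
    simp at h
  · rintro ⟨b, c, h, e⟩
    exact ⟨_, b, c, fun h0 => h (Prod.mk.inj h0).2, e, by ring⟩

theorem mem_skew_iff_of_eq {P : PG2 F} {p r a b c : K} (h : (b, c) ≠ 0)
    (hP : P.submodule = Submodule.span F {f.vec a b c}) :
    P ∈ f.skew p r ↔ a = p * b + r * c := by
  have h' : (a, b, c) ≠ 0 := fun h0 => h (Prod.mk.inj h0).2
  have : P = f.pt h' := Projectivization.submodule_injective (by rw [hP, submodule_pt])
  rw [this, skew, pt_mem_line]
  constructor
  · intro e; linear_combination e
  · rintro rfl; ring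

theorem ne_infinity_of_eq {T P : PG2 F} (hT : T.submodule = Submodule.span F {f.vec 1 0 0})
    {a b c : K} (h : (b, c) ≠ 0) (hP : P.submodule = Submodule.span F {f.vec a b c}) :
    P ≠ T := by
  rintro rfl
  obtain ⟨k, -, hb, hc⟩ := f.exists_of_span_vec_eq (by simp) (hT.symm.trans hP)
  exact h (by rw [hb, hc]; simp)

theorem exists_of_ne_infinity {T P : PG2 F}
    (hT : T.submodule = Submodule.span F {f.vec 1 0 0}) (hP : P ∈ f.plane) (hne : P ≠ T) :
    ∃ a b c : K, (b, c) ≠ 0 ∧ P.submodule = Submodule.span F {f.vec a b c} := by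
  obtain ⟨a, b, c, h, e⟩ := hP
  refine ⟨a, b, c, fun h0 => hne ?_, e⟩
  obtain ⟨rfl, rfl⟩ := Prod.mk.inj h0
  apply Projectivization.submodule_injective
  have ha : a ≠ 0 := by rintro rfl; exact h rfl
  have := f.vec_smul a 1 0 0
  rw [mul_one, mul_zero] at this
  rw [e, hT, this, span_singleton_smul (by simpa using ha)]

theorem mem_thru_diff_iff {T P : PG2 F} (hT : T.submodule = Submodule.span F {f.vec 1 0 0})
    {b c : K} (h : (b, c) ≠ 0) :
    P ∈ f.thru b c \ {T} ↔ ∃ a : K, P.submodule = Submodule.span F {f.vec a b c} := by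
  constructor
  · rintro ⟨hP, hne⟩
    obtain ⟨a, x, y, hxy, e⟩ := f.exists_of_ne_infinity hT hP.1 hne
    have hl := hP.2
    rw [e, Submodule.span_singleton_le_iff_mem, vec_mem_lineSpace] at hl
    have hl : c * x = b * y := by linear_combination hl
    have key : ∃ k : K, k ≠ 0 ∧ x = k * b ∧ y = k * c := by
      by_cases hb : b = 0
      · have hc : c ≠ 0 := fun hc => h (by rw [hb, hc]; rfl)
        have hx : x = 0 := by simpa [hb, hc] using hl
        refine ⟨y / c, div_ne_zero (fun hy => hxy (by rw [hx, hy]; rfl)) hc, ?_, ?_⟩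
        · rw [hb, hx]; ring
        · field_simp
      · refine ⟨x / b, div_ne_zero ?_ hb, ?_, ?_⟩
        · rintro rfl
          have hy : y = 0 := by simpa [hb] using hl.symm
          exact hxy (by rw [hy]; rfl)
        · field_simp
        · field_simp; linear_combination -hl
    obtain ⟨k, hk, rfl, rfl⟩ := key
    refine ⟨a / k, ?_⟩
    rw [e, ← span_singleton_smul (K := F) (k := algebraMap K F k) (by simpa using hk)
      (f.vec (a / k) b c), ← vec_smul, mul_div_cancel₀ _ hk]
  · rintro ⟨a, e⟩
    refine ⟨f.mem_line_iff.2 ⟨a, b, c, fun h0 => h (Prod.mk.inj h0).2, e, by ring⟩, ?_⟩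
    exact f.ne_infinity_of_eq hT h e

theorem thru_smul {k : K} (hk : k ≠ 0) (b c : K) : f.thru (k * b) (k * c) = f.thru b c := by
  rw [thru, thru, ← f.line_smul hk 0 c]
  congr 1 <;> ring

theorem exists_dual {b c : K} (h : (b, c) ≠ 0) : ∃ p r : K, p * b + r * c = 1 := by
  obtain ⟨s, t, e⟩ := exists_complement h
  exact ⟨t, -s, by linear_combination e⟩

section Traces

variable {f} {T : PG2 F} (hT : T.submodule = Submodule.span F {f.vec 1 0 0})
  (hF : Module.finrank K F = 3)

include hT hF

/-- The lines through P missing T are the solutions (p', r') of p'b + r'c = a, namely a(p, r) +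
k(-c, b). Slopes are linear in (p', r'), and the slope of (-c, b) is b + cτ. -/
theorem mem_tracesAt_iff {P : PG2 F} {a b c : K} (h : (b, c) ≠ 0)
    (hP : P.submodule = Submodule.span F {f.vec a b c}) {p r : K} (hpr : p * b + r * c = 1)
    {I : PG6 K F} : I ∈ tracesAt K f.plane T P ↔ ∃ k : K, I.submodule =
      Submodule.span K {f.scaled b c (a • f.slope p r + k • linForm f.τ b c, 1)} := by
  have hs : ∀ k : K, f.slope (a * p - k * c) (a * r + k * b) =
      a • f.slope p r + k • linForm f.τ b c := by
    intro k
    simp only [slope, linForm, Algebra.smul_def, map_add, map_sub, map_mul]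
    ring
  constructor
  · rintro ⟨l, hl, hPl, hTl, hI⟩
    rcases f.isLineOf_iff.1 hl with ⟨x, y, -, rfl⟩ | ⟨p', r', rfl⟩
    · exact absurd (f.mem_thru_of_infinity hT x y) hTl
    · have ha := (f.mem_skew_iff_of_eq h hP).1 hPl
      rw [ha] at hP
      rw [f.isTangentTrace_skew_iff hF h hP] at hI
      -- This determinant is the parameter k of the line, by Cramer's rule with pb + rc = 1.
      refine ⟨p * r' - r * p', ?_⟩
      have e1 : a * p - (p * r' - r * p') * c = p' := by rw [ha]; linear_combination p' * hpr
      have e2 : a * r + (p * r' - r * p') * b = r' := by rw [ha]; linear_combination r' * hpr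
      rw [hI, ← hs, e1, e2]
  · rintro ⟨k, hI⟩
    have ha : a = (a * p - k * c) * b + (a * r + k * b) * c := by linear_combination -a * hpr
    refine ⟨f.skew (a * p - k * c) (a * r + k * b), f.isLineOf_skew _ _,
      (f.mem_skew_iff_of_eq h hP).2 ha, f.not_mem_skew_of_infinity hT _ _, ?_⟩
    rw [f.isTangentTrace_skew_iff hF h (by rw [← ha, hP]), hI, hs]

theorem traceLine_eq {P : PG2 F} {a b c : K} (h : (b, c) ≠ 0)
    (hP : P.submodule = Submodule.span F {f.vec a b c}) {p r : K} (hpr : p * b + r * c = 1) :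
    traceLine K f.plane T P = Submodule.span K
      {f.scaled b c (linForm f.τ b c, 0), f.scaled b c (a • f.slope p r, 1)} := by
  have hsplit : ∀ k : K, f.scaled b c (a • f.slope p r + k • linForm f.τ b c, 1) =
      k • f.scaled b c (linForm f.τ b c, 0) + f.scaled b c (a • f.slope p r, 1) := by
    intro k
    rw [← map_smul, ← map_add]
    congr 1
    simp [add_comm]
  have hne : ∀ k : K, f.scaled b c (a • f.slope p r + k • linForm f.τ b c, 1) ≠ 0 := by
    intro k h0
    have := f.scaled_injective h (h0.trans (map_zero _).symm)
    exact one_ne_zero (Prod.mk.inj this).2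
  have hmem : ∀ k : K, f.scaled b c (a • f.slope p r + k • linForm f.τ b c, 1) ∈
      traceLine K f.plane T P := by
    intro k
    have : Projectivization.mk K _ (hne k) ∈ tracesAt K f.plane T P :=
      (mem_tracesAt_iff hT hF h hP hpr).2 ⟨k, Projectivization.submodule_mk _ _⟩
    refine (le_iSup₂_of_le (f := fun (I : PG6 K F) (_ : I ∈ tracesAt K f.plane T P) =>
      I.submodule) _ this le_rfl : _ ≤ traceLine K f.plane T P) ?_
    rw [Projectivization.submodule_mk]
    exact Submodule.mem_span_singleton_self _
  -- The traces with k = 0 and k = 1 already span; their difference is the vector in the direction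
  -- t.
  have m0 := hmem 0
  have m1 := hmem 1
  rw [hsplit, zero_smul, zero_add] at m0
  rw [hsplit, one_smul] at m1
  apply le_antisymm
  · refine iSup₂_le fun I hI => ?_
    obtain ⟨k, e⟩ := (mem_tracesAt_iff hT hF h hP hpr).1 hI
    rw [e, Submodule.span_singleton_le_iff_mem, hsplit, Submodule.mem_span_pair]
    exact ⟨k, 1, by rw [one_smul]⟩
  · rw [Submodule.span_le]
    rintro v (rfl | rfl)
    · exact (Submodule.add_mem_iff_left _ m0).1 m1
    · exact m0

theorem ncard_tracesAt [Finite K] {P : PG2 F} {a b c : K} (h : (b, c) ≠ 0)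
    (hP : P.submodule = Submodule.span F {f.vec a b c}) :
    (tracesAt K f.plane T P).ncard = Nat.card K := by
  obtain ⟨p, r, hpr⟩ := exists_dual h
  have hne : ∀ k : K, f.scaled b c (a • f.slope p r + k • linForm f.τ b c, 1) ≠ 0 := by
    intro k h0
    have := f.scaled_injective h (h0.trans (map_zero _).symm)
    exact one_ne_zero (Prod.mk.inj this).2
  have : tracesAt K f.plane T P = Set.range fun k : K => Projectivization.mk K _ (hne k) := by
    ext I
    rw [mem_tracesAt_iff hT hF h hP hpr, Set.mem_range]
    refine exists_congr fun k => ?_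
    rw [← Projectivization.submodule_injective.eq_iff, Projectivization.submodule_mk]
    exact eq_comm
  rw [this, ← Nat.card_coe_set_eq, Nat.card_range_of_injective]
  intro k k' e
  rw [← Projectivization.submodule_injective.eq_iff, Projectivization.submodule_mk,
    Projectivization.submodule_mk] at e
  have hmem := e ▸ Submodule.mem_span_singleton_self (R := K)
    (f.scaled b c (a • f.slope p r + k • linForm f.τ b c, 1))
  obtain ⟨x, hx⟩ := Submodule.mem_span_singleton.1 hmem
  rw [← map_smul] at hx
  have hx := f.scaled_injective h hx
  obtain ⟨e1, e2⟩ := Prod.mk.inj hx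
  have hx1 : x = 1 := by
    rw [← Algebra.algebraMap_eq_smul_one] at e2
    exact (algebraMap K F).injective (by rw [e2, map_one])
  rw [hx1, one_smul] at e1
  exact (smul_left_injective K (linForm_ne_zero f.not_mem h) (add_left_cancel e1)).symm

theorem traceLine_inf {P : PG2 F} {a b c : K} (h : (b, c) ≠ 0)
    (hP : P.submodule = Submodule.span F {f.vec a b c}) :
    traceLine K f.plane T P ⊓ spreadElt K T =
      Submodule.span K {atInf K ((1 / linForm f.τ b c) • f.t)} := by
  obtain ⟨p, r, hpr⟩ := exists_dual h
  rw [traceLine_eq hT hF h hP hpr, ← scaled_linForm f h]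
  ext v
  rw [Submodule.mem_inf, Submodule.mem_span_pair, Submodule.mem_span_singleton]
  constructor
  · rintro ⟨⟨x, y, rfl⟩, hv⟩
    refine ⟨x, ?_⟩
    rw [← map_smul, ← map_smul, ← map_add, Prod.smul_mk, Prod.smul_mk, Prod.mk_add_mk,
      f.scaled_mem_spreadElt_infinity hT h] at hv
    have hy : y = 0 := by simpa using hv
    rw [hy, zero_smul, add_zero]
  · rintro ⟨x, rfl⟩
    refine ⟨⟨x, 0, by simp⟩, Submodule.smul_mem _ _ ?_⟩
    rw [f.scaled_mem_spreadElt_infinity hT h]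

theorem finrank_traceLine {P : PG2 F} {a b c : K} (h : (b, c) ≠ 0)
    (hP : P.submodule = Submodule.span F {f.vec a b c}) :
    Module.finrank K (traceLine K f.plane T P) = 2 := by
  obtain ⟨p, r, hpr⟩ := exists_dual h
  rw [traceLine_eq hT hF h hP hpr]
  have hli : LinearIndependent K
      ![f.scaled b c (linForm f.τ b c, 0), f.scaled b c (a • f.slope p r, 1)] := by
    rw [LinearIndependent.pair_iff]
    intro x y e
    rw [← map_smul, ← map_smul, ← map_add] at e
    have e := f.scaled_injective h (e.trans (map_zero _).symm)
    obtain ⟨e1, e2⟩ := Prod.mk.inj e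
    have hy : y = 0 := by simpa using e2
    subst hy
    simp [linForm_ne_zero f.not_mem h] at e1
    exact ⟨e1, rfl⟩
  have := finrank_span_eq_card hli
  rwa [Matrix.range_cons_cons_empty, Fintype.card_fin] at this

/-- The trace plane is spanned by `(1, 0)`, `(τ, 0)` and `(0, 1)` in scaled coordinates. -/
theorem mem_tracePlane_iff {b c : K} (h : (b, c) ≠ 0) {v : Vec K F} :
    v ∈ tracePlane K f.plane T (f.thru b c) ↔
      ∃ x y z : K, v = f.scaled b c (linForm f.τ x y, algebraMap K F z) := by
  obtain ⟨p, r, hpr⟩ := exists_dual h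
  have hle : ∀ a : K, ∃ P ∈ f.thru b c \ {T}, traceLine K f.plane T P = Submodule.span K
      {f.scaled b c (linForm f.τ b c, 0), f.scaled b c (a • f.slope p r, 1)} := by
    intro a
    have h' : (a, b, c) ≠ 0 := fun h0 => h (Prod.mk.inj h0).2
    exact ⟨f.pt h', (f.mem_thru_diff_iff hT h).2 ⟨a, f.submodule_pt h'⟩,
      traceLine_eq hT hF h (f.submodule_pt h') hpr⟩
  have hsub : ∀ P ∈ f.thru b c \ {T}, traceLine K f.plane T P ≤
      tracePlane K f.plane T (f.thru b c) := fun P hP => le_iSup₂_of_le P hP le_rfl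
  have m0 : f.scaled b c (linForm f.τ b c, 0) ∈ tracePlane K f.plane T (f.thru b c) := by
    obtain ⟨P, hP, e⟩ := hle 0
    refine hsub P hP ?_
    rw [e]; exact Submodule.subset_span (by simp)
  have m1 : ∀ a : K, f.scaled b c (a • f.slope p r, 1) ∈
      tracePlane K f.plane T (f.thru b c) := by
    intro a
    obtain ⟨P, hP, e⟩ := hle a
    refine hsub P hP ?_
    rw [e]; exact Submodule.subset_span (by simp)
  have m2 : f.scaled b c (f.slope p r, 0) ∈ tracePlane K f.plane T (f.thru b c) := by
    have := Submodule.sub_mem _ (m1 1) (m1 0)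
    rw [← map_sub] at this
    simpa using this
  constructor
  · intro hv
    let S : Submodule K (Vec K F) := Submodule.span K (Set.range
      ![f.scaled b c (1, 0), f.scaled b c (f.τ, 0), f.scaled b c (0, 1)])
    have hS : ∀ v, v ∈ S ↔ ∃ x y z : K, v = f.scaled b c (linForm f.τ x y, algebraMap K F z) := by
      intro v
      rw [Submodule.mem_span_range_iff_exists_fun]
      have key : ∀ x y z : K, x • f.scaled b c (1, 0) + y • f.scaled b c (f.τ, 0) +
          z • f.scaled b c (0, 1) = f.scaled b c (linForm f.τ x y, algebraMap K F z) := by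
        intro x y z
        rw [← map_smul, ← map_smul, ← map_smul, ← map_add, ← map_add]
        congr 1
        simp [linForm, Algebra.smul_def]
      constructor
      · rintro ⟨g, rfl⟩
        exact ⟨g 0, g 1, g 2, by simpa [Fin.sum_univ_three] using key (g 0) (g 1) (g 2)⟩
      · rintro ⟨x, y, z, rfl⟩
        exact ⟨![x, y, z], by simpa [Fin.sum_univ_three] using key x y z⟩
    have hle : tracePlane K f.plane T (f.thru b c) ≤ S := by
      refine iSup₂_le fun P hP => ?_
      obtain ⟨a, e⟩ := (f.mem_thru_diff_iff hT h).1 hP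
      rw [traceLine_eq hT hF h e hpr, Submodule.span_le]
      rintro v (rfl | rfl)
      · exact (hS _).2 ⟨b, c, 0, by rw [map_zero]⟩
      · refine (hS _).2 ⟨a * r, -(a * p), 1, ?_⟩
        rw [map_one]
        congr 2
        simp only [slope, linForm, Algebra.smul_def, map_neg, map_mul]
        ring
    exact (hS v).1 (hle hv)
  · rintro ⟨x, y, z, rfl⟩
    -- Expansion of x + yτ in the basis b + cτ, r - pτ of K + Kτ; the change of basis has
    -- determinant pb + rc = 1.
    have e : f.scaled b c (linForm f.τ x y, algebraMap K F z) =
        (p * x + r * y) • f.scaled b c (linForm f.τ b c, 0) +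
          (c * x - b * y) • f.scaled b c (f.slope p r, 0) +
          z • f.scaled b c ((0 : K) • f.slope p r, 1) := by
      rw [← map_smul, ← map_smul, ← map_smul, ← map_add, ← map_add]
      congr 1
      have hprF := congrArg (algebraMap K F) hpr
      simp only [map_add, map_mul, map_one] at hprF
      refine Prod.ext ?_ ?_
      · simp only [Prod.fst_add, Prod.smul_fst, zero_smul, smul_zero, add_zero]
        simp only [linForm, slope, Algebra.smul_def, map_add, map_sub, map_mul]
        linear_combination (-(algebraMap K F x + algebraMap K F y * f.τ)) * hprF
      · simp [Algebra.smul_def]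
    rw [e]
    exact add_mem (add_mem (Submodule.smul_mem _ _ m0) (Submodule.smul_mem _ _ m2))
      (Submodule.smul_mem _ _ (m1 0))

theorem ncard_traceLine_image [Finite K] {b c : K} (h : (b, c) ≠ 0) :
    (traceLine K f.plane T '' (f.thru b c \ {T})).ncard = Nat.card K := by
  obtain ⟨p, r, hpr⟩ := exists_dual h
  have : traceLine K f.plane T '' (f.thru b c \ {T}) = Set.range fun a : K => Submodule.span K
      {f.scaled b c (linForm f.τ b c, 0), f.scaled b c (a • f.slope p r, 1)} := by
    ext W
    constructor
    · rintro ⟨P, hP, rfl⟩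
      obtain ⟨a, e⟩ := (f.mem_thru_diff_iff hT h).1 hP
      exact ⟨a, (traceLine_eq hT hF h e hpr).symm⟩
    · rintro ⟨a, rfl⟩
      have h' : (a, b, c) ≠ 0 := fun h0 => h (Prod.mk.inj h0).2
      exact ⟨f.pt h', (f.mem_thru_diff_iff hT h).2 ⟨a, f.submodule_pt h'⟩,
        traceLine_eq hT hF h (f.submodule_pt h') hpr⟩
  rw [this, ← Nat.card_coe_set_eq, Nat.card_range_of_injective]
  intro a a' e
  dsimp only at e
  have hmem : f.scaled b c (a • f.slope p r, 1) ∈ Submodule.span K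
      {f.scaled b c (linForm f.τ b c, 0), f.scaled b c (a' • f.slope p r, 1)} := by
    rw [← e]; exact Submodule.subset_span (by simp)
  obtain ⟨x, y, hxy⟩ := Submodule.mem_span_pair.1 hmem
  rw [← map_smul, ← map_smul, ← map_add] at hxy
  have e1 := congrArg Prod.fst (f.scaled_injective h hxy)
  have e2 := congrArg Prod.snd (f.scaled_injective h hxy)
  simp only [Prod.fst_add, Prod.smul_fst, Prod.snd_add, Prod.smul_snd] at e1 e2
  have hy : y = 1 := by
    simp only [smul_zero, zero_add] at e2
    rw [← Algebra.algebraMap_eq_smul_one] at e2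
    exact (algebraMap K F).injective (by rw [e2, map_one])
  subst hy
  have e3 : linForm f.τ (x * b + (a' - a) * r) (x * c - (a' - a) * p) = 0 := by
    simp only [linForm, slope, Algebra.smul_def, map_add, map_sub, map_mul, map_one] at e1 ⊢
    linear_combination e1
  obtain ⟨h1, h2⟩ := (linForm_eq_zero f.not_mem).1 e3
  -- Eliminating x from the two coordinates leaves (a' - a)(pb + rc).
  linear_combination -(c * h1 - b * h2 - (a' - a) * hpr)

theorem tracePlane_inf_infinity {b c : K} (h : (b, c) ≠ 0) {v : Vec K F} :
    v ∈ tracePlane K f.plane T (f.thru b c) ⊓ spreadElt K T ↔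
      ∃ x y : K, v = f.scaled b c (linForm f.τ x y, 0) := by
  rw [Submodule.mem_inf, mem_tracePlane_iff hT hF h]
  constructor
  · rintro ⟨⟨x, y, z, rfl⟩, hv⟩
    rw [f.scaled_mem_spreadElt_infinity hT h] at hv
    exact ⟨x, y, by rw [hv]⟩
  · rintro ⟨x, y, rfl⟩
    exact ⟨⟨x, y, 0, by rw [map_zero]⟩, (f.scaled_mem_spreadElt_infinity hT h).2 rfl⟩

/-- A vector of [L] is fixed by its w-coordinate, which here is z in K up to the common scale;
conversely the slope r - pτ lies in K + Kτ, so d/λ² does belong to the plane. -/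
theorem tracePlane_inf_spreadElt {L : PG2 F} {p r : K}
    (hL : L.submodule = Submodule.span F {![(f.dir p r).1, (f.dir p r).2, 0]})
    {b c : K} (h : (b, c) ≠ 0) :
    tracePlane K f.plane T (f.thru b c) ⊓ spreadElt K L =
      Submodule.span K {f.scaled b c (f.slope p r, 1)} := by
  ext v
  rw [Submodule.mem_inf, mem_tracePlane_iff hT hF h, Submodule.mem_span_singleton]
  have key : ∀ k : K, k • f.scaled b c (f.slope p r, 1) =
      f.scaled b c (algebraMap K F k * f.slope p r, algebraMap K F k) := by
    intro k
    rw [← map_smul, Prod.smul_mk, Algebra.smul_def, Algebra.smul_def, mul_one]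
  constructor
  · rintro ⟨⟨x, y, z, rfl⟩, hv⟩
    rw [f.scaled_mem_spreadElt hL h] at hv
    exact ⟨z, by rw [key, hv]⟩
  · rintro ⟨k, rfl⟩
    rw [key]
    refine ⟨⟨k * r, -(k * p), k, ?_⟩, (f.scaled_mem_spreadElt hL h).2 rfl⟩
    congr 2
    simp only [linForm, slope, map_neg, map_mul]
    ring

theorem finrank_tracePlane {b c : K} (h : (b, c) ≠ 0) :
    Module.finrank K (tracePlane K f.plane T (f.thru b c)) = 3 := by
  have hli : LinearIndependent K
      ![f.scaled b c (1, 0), f.scaled b c (f.τ, 0), f.scaled b c (0, 1)] := by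
    rw [Fintype.linearIndependent_iff]
    intro g hg
    simp only [Fin.sum_univ_three, Matrix.cons_val_zero, Matrix.cons_val_one, Matrix.cons_val,
      ← map_smul, ← map_add] at hg
    have e1 := congrArg Prod.fst (f.scaled_injective h (hg.trans (map_zero _).symm))
    have e2 := congrArg Prod.snd (f.scaled_injective h (hg.trans (map_zero _).symm))
    have h2 : g 2 = 0 := by simpa using e2
    have h01 : linForm f.τ (g 0) (g 1) = 0 := by
      simpa [linForm, Algebra.smul_def] using e1
    obtain ⟨h0, h1⟩ := (linForm_eq_zero f.not_mem).1 h01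
    intro i; fin_cases i <;> assumption
  have hspan : tracePlane K f.plane T (f.thru b c) = Submodule.span K (Set.range
      ![f.scaled b c (1, 0), f.scaled b c (f.τ, 0), f.scaled b c (0, 1)]) := by
    ext v
    rw [mem_tracePlane_iff hT hF h, Submodule.mem_span_range_iff_exists_fun]
    have key : ∀ x y z : K, x • f.scaled b c (1, 0) + y • f.scaled b c (f.τ, 0) +
        z • f.scaled b c (0, 1) = f.scaled b c (linForm f.τ x y, algebraMap K F z) := by
      intro x y z
      rw [← map_smul, ← map_smul, ← map_smul, ← map_add, ← map_add]
      congr 1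
      simp [linForm, Algebra.smul_def]
    constructor
    · rintro ⟨x, y, z, rfl⟩
      exact ⟨![x, y, z], by simpa [Fin.sum_univ_three] using key x y z⟩
    · rintro ⟨g, rfl⟩
      exact ⟨g 0, g 1, g 2, by simpa [Fin.sum_univ_three] using key (g 0) (g 1) (g 2)⟩
  rw [hspan, finrank_span_eq_card hli, Fintype.card_fin]

theorem tracePlane_le_hypInfty {b c : K} (h : (b, c) ≠ 0) :
    tracePlane K f.plane T (f.thru b c) ≤ hypInfty K F := by
  intro v hv
  obtain ⟨x, y, z, rfl⟩ := (mem_tracePlane_iff hT hF h).1 hv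
  exact rfl

omit hF in
theorem exists_skew_of_mem_splash {L : PG2 F} (hL : L ∈ splash f.plane) (hne : L ≠ T) :
    ∃ p r : K, L.submodule = Submodule.span F {![(f.dir p r).1, (f.dir p r).2, 0]} := by
  obtain ⟨hi, l, hl, hle⟩ := hL
  rcases f.isLineOf_iff.1 hl with ⟨b, c, h, rfl⟩ | ⟨p, r, rfl⟩
  · rw [f.extLine_thru h, f.le_lineSpace_thru hT hi h] at hle
    exact absurd hle hne
  · rw [f.extLine_skew, f.le_lineSpace_skew hi] at hle
    exact ⟨p, r, hle⟩

omit hF in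
theorem eq_skew_iff {L : PG2 F} (hi : L.submodule ≤ lineInfty F) (hne : L ≠ T) {p r : K}
    (hL : L.submodule = Submodule.span F {![(f.dir p r).1, (f.dir p r).2, 0]})
    {l : Set (PG2 F)} : (IsLineOf f.plane l ∧ L.submodule ≤ extLine l) ↔ l = f.skew p r := by
  constructor
  · rintro ⟨hl, hle⟩
    rcases f.isLineOf_iff.1 hl with ⟨b, c, h, rfl⟩ | ⟨p', r', rfl⟩
    · rw [f.extLine_thru h, f.le_lineSpace_thru hT hi h] at hle
      exact absurd hle hne
    · rw [f.extLine_skew, f.le_lineSpace_skew hi] at hle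
      obtain ⟨rfl, rfl⟩ := f.dir_inj (hL.symm.trans hle)
      rfl
  · rintro rfl
    exact ⟨f.isLineOf_skew p r, by rw [f.extLine_skew, f.le_lineSpace_skew hi, hL]⟩

theorem isCoverPlane_tracePlane {b c : K} (h : (b, c) ≠ 0) :
    IsCoverPlane f.plane (tracePlane K f.plane T (f.thru b c)) := by
  refine ⟨finrank_tracePlane hT hF h, tracePlane_le_hypInfty hT hF h, fun U hU => ?_⟩
  rw [Submodule.ne_bot_iff]
  by_cases hUT : U = T
  · subst hUT
    refine ⟨f.scaled b c (linForm f.τ 1 0, 0),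
      (tracePlane_inf_infinity hT hF h).2 ⟨1, 0, rfl⟩, ?_⟩
    intro h0
    obtain ⟨e, -⟩ := Prod.mk.inj (f.scaled_injective h (h0.trans (map_zero _).symm))
    exact linForm_ne_zero f.not_mem (by simp) e
  · obtain ⟨p, r, hL⟩ := exists_skew_of_mem_splash hT hU hUT
    rw [tracePlane_inf_spreadElt hT hF hL h]
    refine ⟨_, Submodule.mem_span_singleton_self _, ?_⟩
    intro h0
    obtain ⟨-, e⟩ := Prod.mk.inj (f.scaled_injective h (h0.trans (map_zero _).symm))
    exact one_ne_zero e

end Traces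

end Frame

/-! ### Binary forms and counting over a projective line -/

section Proportional

variable {K F : Type*} [Field K] [Field F] [Algebra K F]

theorem exists_smul_of_mul_eq_mul {b c b' c' : K} (h : (b, c) ≠ 0) (h' : (b', c') ≠ 0)
    (e : b * c' = c * b') : ∃ k : K, k ≠ 0 ∧ b' = k * b ∧ c' = k * c := by
  by_cases hb : b = 0
  · have hc : c ≠ 0 := fun hc => h (by rw [hb, hc]; rfl)
    have hb' : b' = 0 := by simpa [hb, hc] using e.symm
    refine ⟨c' / c, div_ne_zero (fun hc' => h' (by rw [hb', hc']; rfl)) hc, ?_, ?_⟩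
    · rw [hb, hb']; ring
    · field_simp
  · refine ⟨b' / b, div_ne_zero ?_ hb, ?_, ?_⟩
    · rintro rfl
      have : c' = 0 := by simpa [hb] using e
      exact h' (by rw [this]; rfl)
    · field_simp
    · field_simp; linear_combination e

/-- The number of values of a function of the points of a projective line. -/
theorem ncard_of_homogeneous [Finite K] {α : Type*} (φ : K → K → α)
    (hs : ∀ k : K, k ≠ 0 → ∀ b c, φ (k * b) (k * c) = φ b c)
    (hi : ∀ b c b' c' : K, (b, c) ≠ 0 → (b', c') ≠ 0 → φ b c = φ b' c' → b * c' = c * b') :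
    {x | ∃ b c : K, (b, c) ≠ 0 ∧ x = φ b c}.ncard = Nat.card K + 1 := by
  have : {x | ∃ b c : K, (b, c) ≠ 0 ∧ x = φ b c} =
      Set.range fun v : ℙ K (K × K) => φ v.rep.1 v.rep.2 := by
    ext x
    constructor
    · rintro ⟨b, c, h, rfl⟩
      obtain ⟨k, hk⟩ := Projectivization.exists_smul_eq_mk_rep K (b, c) h
      refine ⟨Projectivization.mk K (b, c) h, ?_⟩
      simp only [← hk]
      exact hs k k.ne_zero b c
    · rintro ⟨v, rfl⟩
      exact ⟨v.rep.1, v.rep.2, v.rep_nonzero, rfl⟩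
  rw [this, ← Nat.card_coe_set_eq, Nat.card_range_of_injective,
    Projectivization.card_of_finrank_two K (K × K) (by simp)]
  intro v w e
  obtain ⟨k, -, e1, e2⟩ := exists_smul_of_mul_eq_mul v.rep_nonzero w.rep_nonzero
    (hi _ _ _ _ v.rep_nonzero w.rep_nonzero e)
  rw [← v.mk_rep, ← w.mk_rep, eq_comm, Projectivization.mk_eq_mk_iff']
  exact ⟨k, Prod.ext e1.symm e2.symm⟩

/-- Unique factorisation of binary quadratic forms, evaluated at an element of degree three. -/
theorem mul_eq_mul_of_linForm_sq (hF : Module.finrank K F = 3) {τ : F}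
    (hτ : τ ∉ Set.range (algebraMap K F)) {b c x y z w : K}
    (h : linForm τ b c ^ 2 = linForm τ x y * linForm τ z w) : b * y = c * x := by
  obtain ⟨h0, h1, h2⟩ := eq_zero_of_quadratic hF hτ (a := b ^ 2 - x * z)
    (b := 2 * b * c - x * w - y * z) (c := c ^ 2 - y * w) (by
      simp only [linForm] at h
      simp only [map_sub, map_mul, map_pow, map_ofNat]
      linear_combination h)
  -- Independence of 1, τ, τ² gives (bU + cV)² = (xU + yV)(zU + wV) as forms; this evaluates it at
  -- (U, V) = (y, -x).
  have : (b * y - c * x) ^ 2 = 0 := by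
    linear_combination y ^ 2 * h0 - x * y * h1 + x ^ 2 * h2
  exact sub_eq_zero.1 (pow_eq_zero_iff two_ne_zero |>.1 this)

theorem linForm_mul (τ : F) (k s t : K) :
    linForm τ (k * s) (k * t) = algebraMap K F k * linForm τ s t := by
  simp only [linForm, map_mul]; ring

end Proportional

namespace Frame

variable {K F : Type*} [Field K] [Field F] [Algebra K F] (f : Frame K F)

/-! ### The conic directrix -/

/-- The conic directrix, in coordinates. -/
def conic : Set (PG6 K F) :=
  {X | ∃ b c : K, (b, c) ≠ 0 ∧
    X.submodule = Submodule.span K {atInf K ((1 / linForm f.τ b c) • f.t)}}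

theorem conicVec_ne {b c : K} (h : (b, c) ≠ 0) :
    atInf K ((1 / linForm f.τ b c) • f.t) ≠ 0 := by
  rw [map_ne_zero_iff _ atInf_injective]
  exact smul_ne_zero (div_ne_zero one_ne_zero (linForm_ne_zero f.not_mem h)) f.t_ne_zero

theorem t_smul_injective {α β : F} (h : atInf K (α • f.t) = atInf K (β • f.t)) : α = β :=
  smul_left_injective F f.t_ne_zero (atInf_injective h)

variable {f} {T : PG2 F} (hT : T.submodule = Submodule.span F {f.vec 1 0 0})
  (hF : Module.finrank K F = 3)

theorem conicVec_eq {A E N : K} (hc : IsCubicRoot A E N f.τ) {s t : K} (h : (s, t) ≠ 0) :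
    conicVec (conicOf A E f.τ f.t) s t =
      normForm A E N s t • atInf K ((1 / linForm f.τ s t) • f.t) := by
  have hl := linForm_ne_zero f.not_mem h
  rw [conicVec_conicOf, ← map_smul, ← algebraMap_smul F (normForm A E N s t), smul_smul,
    ← linForm_mul_adjForm hc]
  congr 2
  field_simp

/-- Decomposition along a generator: a point of the line `skew 0 0`, whose direction is w, plus a
K-multiple of the conic vector. -/
theorem affPt_eq (a b c : K) :
    f.affPt a b c = subPt f.u f.w f.τ b c + a • (1 / linForm f.τ b c) • f.t := by
  rw [affPt, subPt, ← algebraMap_smul F a, smul_smul, mul_one_div]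
  abel

include hF in
theorem ruledSurface_eq {A E N : K} (hc : IsCubicRoot A E N f.τ) :
    {X | X ∈ ruledSurface (conicOf A E f.τ f.t) (cubicOf A E N f.τ (aff K f.u) f.w) ∧
      ¬ X.submodule ≤ hypInfty K F} = affineImage K f.plane := by
  have hb : (aff K f.u).2.2 ≠ 0 := one_ne_zero
  have hcub : ∀ s t : K, (s, t) ≠ 0 → cubicVec (cubicOf A E N f.τ (aff K f.u) f.w) s t =
      normForm A E N s t • aff K (subPt f.u f.w f.τ s t) := by
    intro s t h
    rw [cubicVec_cubicOf_eq_aff f.not_mem hc hb f.w h]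
    simp [aff]
  have hpt : ∀ a s t : K, aff K (f.affPt a s t) = aff K (subPt f.u f.w f.τ s t) +
      a • atInf K ((1 / linForm f.τ s t) • f.t) := by
    intro a s t
    rw [affPt_eq, ← aff_add_atInf, map_smul]
  rw [affineImage_plane]
  ext X
  constructor
  · rintro ⟨⟨s, t, h, hX⟩, hinf⟩
    have hn := normForm_ne_zero hF f.not_mem hc h
    rw [conicVec_eq hc h, hcub s t h] at hX
    rw [Projectivization.submodule_eq, Submodule.span_singleton_le_iff_mem] at hX hinf
    obtain ⟨x, y, hxy⟩ := Submodule.mem_span_pair.1 hX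
    have hy : y ≠ 0 := by
      rintro rfl
      apply hinf
      rw [← hxy, zero_smul, add_zero]
      exact Submodule.smul_mem _ _ (Submodule.smul_mem _ _ rfl)
    -- Both spanning vectors carry the same norm factor, so only the ratio of their coefficients
    -- matters.
    refine ⟨x / y, s, t, h, ?_⟩
    rw [Projectivization.submodule_eq, ← hxy, hpt,
      ← span_singleton_smul (mul_ne_zero hy hn) (aff K _ + _)]
    congr 2
    rw [smul_add, smul_smul, smul_smul, smul_smul, add_comm]
    congr 2
    field_simp
  · rintro ⟨a, s, t, h, hX⟩
    have hn := normForm_ne_zero hF f.not_mem hc h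
    refine ⟨⟨s, t, h, ?_⟩, ?_⟩
    · rw [hX, Submodule.span_singleton_le_iff_mem, Submodule.mem_span_pair, conicVec_eq hc h,
        hcub s t h, hpt]
      refine ⟨a * (normForm A E N s t)⁻¹, (normForm A E N s t)⁻¹, ?_⟩
      rw [smul_smul, smul_smul, mul_assoc, inv_mul_cancel₀ hn, mul_one, one_smul, add_comm]
    · rw [hX, Submodule.span_singleton_le_iff_mem]
      exact one_ne_zero

include hT hF

theorem isConicDirectrix_conic : IsConicDirectrix f.plane T f.conic := by
  obtain ⟨A, E, N, hc⟩ := exists_isCubicRoot hF f.not_mem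
  have hw : f.w ≠ 0 := by
    intro h
    exact one_ne_zero (f.indep 0 1 (by simp [h])).2
  have hv : (![f.w.1, f.w.2, 0] : Fin 3 → F) ≠ 0 := fun h0 =>
    hw (Prod.ext (congrFun h0 0) (congrFun h0 1))
  have hL : (Projectivization.mk F _ hv).submodule = Submodule.span F {![f.w.1, f.w.2, 0]} :=
    Projectivization.submodule_mk _ _
  have hT' := hT
  rw [vec_one_zero_zero] at hT'
  refine ⟨conicOf A E f.τ f.t, cubicOf A E N f.τ (aff K f.u) f.w, _,
    isSpecialConic_conicOf hF f.not_mem hc f.t_ne_zero hT', ?_, ?_, ?_,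
    isSpecialCubic_cubicOf hF f.not_mem hc one_ne_zero hw hL, ruledSurface_eq hF hc⟩
  · ext X
    refine exists_congr fun s => exists_congr fun t => and_congr_right fun h => ?_
    rw [conicVec_eq hc h, span_singleton_smul (normForm_ne_zero hF f.not_mem hc h)]
  · rw [hL, Submodule.span_singleton_le_iff_mem]
    simp [lineInfty]
  · intro e
    rw [e, hT'] at hL
    have := hL ▸ Submodule.mem_span_singleton_self (R := F) (![f.t.1, f.t.2, 0] : Fin 3 → F)
    obtain ⟨μ, hμ⟩ := Submodule.mem_span_singleton.1 this
    have e : μ • f.w = f.t := Prod.ext (congrFun hμ 0) (congrFun hμ 1)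
    exact one_ne_zero (f.indep 1 (-μ) (by rw [neg_smul, e]; simp)).1

omit hT hF in
/-- Two affine points of the subplane whose difference is a multiple of `t`. -/
theorem exists_eq_of_add_mem {a b c : K} (h : (b, c) ≠ 0) {δ : F} {X : PG6 K F}
    (hX : X ∈ affineImage K f.plane)
    (e : X.submodule = Submodule.span K {aff K (f.affPt a b c + δ • f.t)}) :
    ∃ k : K, δ • f.t = k • (1 / linForm f.τ b c) • f.t := by
  rw [affineImage_plane] at hX
  obtain ⟨a', b', c', h', e'⟩ := hX
  have e := span_aff_inj (e.symm.trans e')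
  have hl := linForm_ne_zero f.not_mem h
  have hl' := linForm_ne_zero f.not_mem h'
  simp only [affPt] at e
  have e : (algebraMap K F a / linForm f.τ b c + δ) • f.t +
      (algebraMap K F c / linForm f.τ b c) • f.w =
      (algebraMap K F a' / linForm f.τ b' c') • f.t +
      (algebraMap K F c' / linForm f.τ b' c') • f.w := by
    rw [add_smul]
    rw [add_assoc, add_assoc, add_assoc] at e
    rw [← add_left_cancel e]; abel
  obtain ⟨e1, e2⟩ := f.coords_inj e
  -- The w-coordinate c/λ alone determines the ratio (b : c).
  have hcross : b * c' = c * b' := by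
    rw [div_eq_div_iff hl hl'] at e2
    apply (algebraMap K F).injective
    simp only [linForm, map_mul] at e2 ⊢
    linear_combination -e2
  obtain ⟨k, hk, rfl, rfl⟩ := exists_smul_of_mul_eq_mul h h' hcross
  refine ⟨a' / k - a, ?_⟩
  rw [← algebraMap_smul F (a' / k - a), smul_smul]
  congr 1
  have hkF : algebraMap K F k ≠ 0 := by simpa using hk
  rw [linForm_mul] at e1
  rw [map_sub, map_div₀]
  field_simp at e1 ⊢
  linear_combination e1

/-- A generator of any such surface has its point at infinity in the direction t, say δt, and
contains two affine points of the subplane differing by δt. By `exists_eq_of_add_mem` this forces δ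
to be a K-multiple of 1/λ. Conversely every (b : c) occurs, since `affPt 0 b c` lies on some
generator. -/
theorem eq_conic_of_isConicDirectrix {C : Set (PG6 K F)}
    (hC : IsConicDirectrix f.plane T C) : C = f.conic := by
  obtain ⟨d, c, L, ⟨hd, hdT, -⟩, rfl, hLi, -, hcs, hruled⟩ := hC
  obtain ⟨A, E, N, ρ, b, m, hρ, hroot, hb, hm, rfl⟩ := exists_eq_cubicOf hF hLi hcs
  have hT' := hT
  rw [vec_one_zero_zero] at hT'
  have hdir : ∀ s t : K, (s, t) ≠ 0 → ∃ δ : F, δ ≠ 0 ∧ conicVec d s t = atInf K (δ • f.t) := by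
    intro s t h
    have hmem : conicVec d s t ∈ spreadElt K T :=
      add_mem (add_mem (Submodule.smul_mem _ _ (hdT 0)) (Submodule.smul_mem _ _ (hdT 1)))
        (Submodule.smul_mem _ _ (hdT 2))
    obtain ⟨δ, e⟩ := (mem_spreadElt_iff hT').1 hmem
    refine ⟨δ, ?_, e⟩
    rintro rfl
    exact conicVec_ne_zero hd h (by rw [e]; simp)
  -- every point `e + x δ` on a generator represents a point of the subplane
  have hgen : ∀ s t : K, (s, t) ≠ 0 → ∀ x y : K, ∀ e : F × F,
      x • conicVec d s t + y • cubicVec (cubicOf A E N ρ b m) s t = aff K e →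
      Projectivization.mk K (aff K e) (aff_ne_zero e) ∈ affineImage K f.plane := by
    intro s t h x y e hxy
    rw [← hruled]
    refine ⟨⟨s, t, h, ?_⟩, ?_⟩
    · rw [Projectivization.submodule_mk, Submodule.span_singleton_le_iff_mem,
        Submodule.mem_span_pair]
      exact ⟨x, y, hxy⟩
    · rw [Projectivization.submodule_mk, Submodule.span_singleton_le_iff_mem]
      exact one_ne_zero
  have hspan : ∀ b c : K, (b, c) ≠ 0 → ∀ δ : F, δ ≠ 0 →
      (∃ k : K, δ • f.t = k • (1 / linForm f.τ b c) • f.t) →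
      Submodule.span K {atInf K (δ • f.t)} =
        Submodule.span K {atInf K ((1 / linForm f.τ b c) • f.t)} := by
    rintro b c h δ hδ ⟨k, hk⟩
    have hk0 : k ≠ 0 := by
      rintro rfl
      rw [zero_smul] at hk
      exact smul_ne_zero hδ f.t_ne_zero hk
    rw [hk, map_smul, span_singleton_smul hk0]
  ext X
  constructor
  · rintro ⟨s, t, h, hX⟩
    obtain ⟨δ, hδ, eδ⟩ := hdir s t h
    have ecub := cubicVec_cubicOf_eq_aff hρ hroot hb m h
    set e := subPt (b.2.2⁻¹ • (b.1, b.2.1)) (b.2.2⁻¹ • m) ρ s t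
    have hn : normForm A E N s t * b.2.2 ≠ 0 :=
      mul_ne_zero (normForm_ne_zero hF hρ hroot h) hb
    have h0 := hgen s t h 0 (normForm A E N s t * b.2.2)⁻¹ e (by
      rw [ecub, zero_smul, zero_add, smul_smul, inv_mul_cancel₀ hn, one_smul])
    have h1 := hgen s t h 1 (normForm A E N s t * b.2.2)⁻¹ (e + δ • f.t) (by
      rw [ecub, one_smul, smul_smul, inv_mul_cancel₀ hn, one_smul, eδ, add_comm, aff_add_atInf])
    have h0' := h0
    rw [affineImage_plane] at h0'
    obtain ⟨a', b', c', h', e'⟩ := h0'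
    rw [Projectivization.submodule_mk] at e'
    have e' := span_aff_inj e'
    rw [e'] at h1
    refine ⟨b', c', h', ?_⟩
    rw [hX, eδ]
    exact hspan b' c' h' δ hδ (exists_eq_of_add_mem h' h1 (Projectivization.submodule_mk _ _))
  · rintro ⟨b', c', h', hX⟩
    have hmem : Projectivization.mk K (aff K (f.affPt 0 b' c')) (aff_ne_zero _) ∈
        affineImage K f.plane := by
      rw [affineImage_plane]
      exact ⟨0, b', c', h', Projectivization.submodule_mk _ _⟩
    rw [← hruled] at hmem
    obtain ⟨⟨s, t, h, hle⟩, -⟩ := hmem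
    rw [Projectivization.submodule_mk, Submodule.span_singleton_le_iff_mem,
      Submodule.mem_span_pair] at hle
    obtain ⟨x, y, hxy⟩ := hle
    obtain ⟨δ, hδ, eδ⟩ := hdir s t h
    -- Raising the conic coefficient by one moves the affine point by δt along the same generator.
    have h1 := hgen s t h (x + 1) y (f.affPt 0 b' c' + δ • f.t) (by
      rw [← aff_add_atInf, ← hxy, ← eδ, add_smul, one_smul]; abel)
    refine ⟨s, t, h, ?_⟩
    rw [hX, eδ]
    exact (hspan b' c' h' δ hδ
      (exists_eq_of_add_mem h' h1 (Projectivization.submodule_mk _ _))).symm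

/-! ### Tangent lines of the conic directrix -/

theorem finrank_tracePlane_inf {b c : K} (h : (b, c) ≠ 0) :
    Module.finrank K (tracePlane K f.plane T (f.thru b c) ⊓ spreadElt K T :
      Submodule K (Vec K F)) = 2 := by
  have hli : LinearIndependent K ![f.scaled b c (1, 0), f.scaled b c (f.τ, 0)] := by
    rw [LinearIndependent.pair_iff]
    intro x y e
    rw [← map_smul, ← map_smul, ← map_add] at e
    have e1 := congrArg Prod.fst (f.scaled_injective h (e.trans (map_zero _).symm))
    have : linForm f.τ x y = 0 := by
      simpa [linForm, Algebra.smul_def] using e1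
    exact (linForm_eq_zero f.not_mem).1 this
  have hspan : tracePlane K f.plane T (f.thru b c) ⊓ spreadElt K T = Submodule.span K
      {f.scaled b c (1, 0), f.scaled b c (f.τ, 0)} := by
    ext v
    rw [tracePlane_inf_infinity hT hF h, Submodule.mem_span_pair]
    refine exists_congr fun x => exists_congr fun y => ?_
    rw [← map_smul, ← map_smul, ← map_add, eq_comm]
    simp [linForm, Algebra.smul_def]
  have := finrank_span_eq_card hli
  rw [Matrix.range_cons_cons_empty, Fintype.card_fin] at this
  rw [hspan, this]

theorem conicVec_mem_tracePlane_inf {b c : K} (h : (b, c) ≠ 0) :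
    atInf K ((1 / linForm f.τ b c) • f.t) ∈
      tracePlane K f.plane T (f.thru b c) ⊓ spreadElt K T := by
  rw [tracePlane_inf_infinity hT hF h]
  exact ⟨b, c, (f.scaled_linForm h).symm⟩

theorem mul_eq_mul_of_mem_tracePlane_inf {b c b' c' : K} (h : (b, c) ≠ 0) (h' : (b', c') ≠ 0)
    (hmem : atInf K ((1 / linForm f.τ b' c') • f.t) ∈
      tracePlane K f.plane T (f.thru b c) ⊓ spreadElt K T) : b * c' = c * b' := by
  obtain ⟨x, y, e⟩ := (tracePlane_inf_infinity hT hF h).1 hmem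
  rw [scaled_apply, mul_zero, zero_smul, add_zero] at e
  have e := f.t_smul_injective e
  have hl := linForm_ne_zero f.not_mem h
  have hl' := linForm_ne_zero f.not_mem h'
  field_simp at e
  exact mul_eq_mul_of_linForm_sq hF f.not_mem (z := x) (w := y) (by linear_combination e)

theorem isTangentLine_tracePlane_inf {b c : K} (h : (b, c) ≠ 0) :
    IsTangentLine T f.conic (tracePlane K f.plane T (f.thru b c) ⊓ spreadElt K T) := by
  refine ⟨finrank_tracePlane_inf hT hF h, inf_le_right,
    Projectivization.mk K _ (f.conicVec_ne h), ⟨⟨b, c, h, Projectivization.submodule_mk _ _⟩, ?_⟩,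
    ?_⟩
  · rw [Projectivization.submodule_mk, Submodule.span_singleton_le_iff_mem]
    exact conicVec_mem_tracePlane_inf hT hF h
  · rintro X ⟨⟨b', c', h', hX⟩, hle⟩
    rw [hX, Submodule.span_singleton_le_iff_mem] at hle
    obtain ⟨k, hk, rfl, rfl⟩ := exists_smul_of_mul_eq_mul h h'
      (mul_eq_mul_of_mem_tracePlane_inf hT hF h h' hle)
    apply Projectivization.submodule_injective
    have e : (1 / linForm f.τ (k * b) (k * c)) • f.t = k⁻¹ • (1 / linForm f.τ b c) • f.t := by
      rw [← algebraMap_smul F k⁻¹, smul_smul, linForm_mul, map_inv₀]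
      congr 1
      rw [one_div, mul_inv, one_div]
    rw [hX, Projectivization.submodule_mk, e, map_smul, span_singleton_smul (inv_ne_zero hk)]

/-- Ranks agree, so one inclusion suffices. With λ = b + cτ for the point of contact and ρ = (r -
pτ)/λ, a vector αt of the line is tested by expanding αλ in 1, A - ρ, ρ² - Aρ + E. Without the last
term it lies in the trace plane; with it the line would carry a second conic point. -/
theorem exists_of_isTangentLine {t : Submodule K (Vec K F)} (ht : IsTangentLine T f.conic t) :
    ∃ b c : K, (b, c) ≠ 0 ∧ t = tracePlane K f.plane T (f.thru b c) ⊓ spreadElt K T := by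
  obtain ⟨ht2, htT, X, ⟨⟨b, c, h, hX⟩, hXt⟩, huniq⟩ := ht
  have : FiniteDimensional K F := Module.finite_of_finrank_pos (by omega)
  refine ⟨b, c, h, Submodule.eq_of_le_of_finrank_eq ?_ ?_⟩
  · have hl := linForm_ne_zero f.not_mem h
    obtain ⟨p, r, hpr⟩ := exists_dual h
    -- the numbers `slope p r` and `b + c τ` form another basis of the span of `1` and `τ`
    obtain ⟨ρ, hρs⟩ : ∃ ρ, f.slope p r = ρ * linForm f.τ b c :=
      ⟨f.slope p r / linForm f.τ b c, by field_simp⟩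
    have hcomb : ∀ k : K, linForm f.τ (k * b + r) (k * c - p) =
        linForm ρ k 1 * linForm f.τ b c := by
      intro k
      have : linForm f.τ (k * b + r) (k * c - p) =
          algebraMap K F k * linForm f.τ b c + f.slope p r := by
        simp only [linForm, slope, map_add, map_sub, map_mul]; ring
      rw [this, hρs]
      simp only [linForm, map_one]
      ring
    have hne : ∀ k : K, (k * b + r, k * c - p) ≠ 0 := by
      intro k e
      obtain ⟨e1, e2⟩ := Prod.mk.inj e
      exact one_ne_zero (α := K) (by linear_combination -hpr + c * e1 - b * e2)
    have hρ : ρ ∉ Set.range (algebraMap K F) := by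
      rintro ⟨k, rfl⟩
      apply linForm_ne_zero f.not_mem (hne (-k))
      rw [hcomb]
      simp [linForm]
    obtain ⟨A, E, N, hroot⟩ := exists_isCubicRoot hF hρ
    have hT' := hT
    rw [vec_one_zero_zero] at hT'
    have hXmem : atInf K ((1 / linForm f.τ b c) • f.t) ∈ t := by
      rwa [hX, Submodule.span_singleton_le_iff_mem] at hXt
    intro v hv
    obtain ⟨α, rfl⟩ := (mem_spreadElt_iff hT').1 (htT hv)
    obtain ⟨x, y, z, hα⟩ := exists_eq_adjBasis hF hρ A E (α * linForm f.τ b c)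
    by_cases hz : z = 0
    · subst hz
      rw [tracePlane_inf_infinity hT hF h]
      refine ⟨(x + y * A) * b - y * r, (x + y * A) * c + y * p, ?_⟩
      rw [scaled_apply, mul_zero, zero_smul, add_zero]
      congr 2
      have e : linForm f.τ ((x + y * A) * b - y * r) ((x + y * A) * c + y * p) =
          algebraMap K F (x + y * A) * linForm f.τ b c - algebraMap K F y * f.slope p r := by
        simp only [linForm, slope, map_add, map_sub, map_mul]; ring
      rw [e, hρs]
      simp only [map_zero, zero_mul, add_zero] at hα
      simp only [map_add, map_mul]
      field_simp
      linear_combination hα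
    · exfalso
      -- For this k, αλ/z differs from `adjForm` at (k, 1) by an element of K. As `adjForm` is a
      -- norm over k + ρ, the point t/((k + ρ)λ) of the conic lies on the line.
      set k := y / z with hk
      have hn := normForm_ne_zero hF hρ hroot (s := k) (t := 1) (by simp)
      have hlk := linForm_ne_zero hρ (s := k) (t := 1) (by simp)
      have hadj := linForm_mul_adjForm hroot k 1
      have hzF : algebraMap K F z ≠ 0 := by simpa using hz
      have e : normForm A E N k 1 • atInf K
          ((1 / linForm f.τ (k * b + r) (k * c - p)) • f.t) =
          z⁻¹ • atInf K (α • f.t) +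
            (k ^ 2 - x / z) • atInf K ((1 / linForm f.τ b c) • f.t) := by
        rw [← map_smul, ← map_smul, ← map_smul, ← map_add, ← algebraMap_smul F (normForm _ _ _ _ _),
          ← algebraMap_smul F z⁻¹, ← algebraMap_smul F (k ^ 2 - x / z), smul_smul, smul_smul,
          smul_smul, ← add_smul, hcomb, ← hadj]
        congr 2
        simp only [hk, adjForm, map_sub, map_div₀, map_pow, map_inv₀, map_one]
        rw [hk] at hlk
        field_simp
        linear_combination (-algebraMap K F z) * hα
      have hYmem : atInf K ((1 / linForm f.τ (k * b + r) (k * c - p)) • f.t) ∈ t := by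
        rw [← Submodule.smul_mem_iff _ hn, e]
        exact add_mem (Submodule.smul_mem _ _ hv) (Submodule.smul_mem _ _ hXmem)
      have hYX := huniq (Projectivization.mk K _ (f.conicVec_ne (hne k)))
        ⟨⟨_, _, hne k, Projectivization.submodule_mk _ _⟩, by
          rwa [Projectivization.submodule_mk, Submodule.span_singleton_le_iff_mem]⟩
      have hspan := congrArg Projectivization.submodule hYX
      rw [Projectivization.submodule_mk, hX] at hspan
      have hmem := hspan ▸ Submodule.mem_span_singleton_self (R := K)
        (atInf K ((1 / linForm f.τ (k * b + r) (k * c - p)) • f.t))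
      obtain ⟨j, hj⟩ := Submodule.mem_span_singleton.1 hmem
      rw [← map_smul, ← algebraMap_smul F j, smul_smul, hcomb] at hj
      have hj := f.t_smul_injective hj
      -- Equality with the point of contact would mean j(k + ρ) = 1 with j in K, impossible since ρ
      -- is not in K.
      have hj0 : linForm ρ (j * k - 1) j = 0 := by
        field_simp at hj
        simp only [linForm, map_one, map_sub, map_mul] at hj ⊢
        linear_combination hj
      obtain ⟨h1, h2⟩ := (linForm_eq_zero hρ).1 hj0
      rw [h2] at h1
      simp at h1
  · rw [ht2, finrank_tracePlane_inf hT hF h]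

end Frame

/-! ### Shadows, and the families of trace planes and tangent lines -/

namespace Frame

variable {K F : Type*} [Field K] [Field F] [Algebra K F] {f : Frame K F} {T : PG2 F}
  (hT : T.submodule = Submodule.span F {f.vec 1 0 0}) (hF : Module.finrank K F = 3)

theorem scaled_slope_ne_zero {b c : K} (h : (b, c) ≠ 0) (p r : K) :
    f.scaled b c (f.slope p r, 1) ≠ 0 := by
  intro h0
  have := congrArg Prod.snd (f.scaled_injective h (h0.trans (map_zero _).symm))
  exact one_ne_zero this

include hF in
theorem existsUnique_isTangentTrace_skew {p r : K} {P : PG2 F} (hP : P ∈ f.skew p r) :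
    ∃! I : PG6 K F, IsTangentTrace P (f.skew p r) I := by
  obtain ⟨b, c, h, e⟩ := f.mem_skew_iff.1 hP
  refine ⟨Projectivization.mk K _ (scaled_slope_ne_zero h p r),
    (f.isTangentTrace_skew_iff hF h e).2 (Projectivization.submodule_mk _ _), fun I hI => ?_⟩
  apply Projectivization.submodule_injective
  rw [(f.isTangentTrace_skew_iff hF h e).1 hI, Projectivization.submodule_mk]

include hF in
theorem image_shadow_skew (p r : K) : Projectivization.submodule '' shadow K (f.skew p r) =
    {W | ∃ b c : K, (b, c) ≠ 0 ∧
      W = Submodule.span K {f.scaled b c (f.slope p r, 1)}} := by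
  ext W
  constructor
  · rintro ⟨I, ⟨P, hP, hI⟩, rfl⟩
    obtain ⟨b, c, h, e⟩ := f.mem_skew_iff.1 hP
    exact ⟨b, c, h, (f.isTangentTrace_skew_iff hF h e).1 hI⟩
  · rintro ⟨b, c, h, rfl⟩
    have h' : (p * b + r * c, b, c) ≠ 0 := fun h0 => h (Prod.mk.inj h0).2
    refine ⟨Projectivization.mk K _ (scaled_slope_ne_zero h p r),
      ⟨f.pt h', f.mem_skew_iff.2 ⟨b, c, h, f.submodule_pt h'⟩, ?_⟩,
      Projectivization.submodule_mk _ _⟩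
    exact (f.isTangentTrace_skew_iff hF h (f.submodule_pt h')).2
      (Projectivization.submodule_mk _ _)

include hF in
-- Comparing w-coordinates gives λ² = λ'(k⁻¹λ') with k in K, and `mul_eq_mul_of_linForm_sq` applies.
theorem mul_eq_mul_of_span_scaled_eq {p r b c b' c' : K} (h : (b, c) ≠ 0) (h' : (b', c') ≠ 0)
    (e : Submodule.span K {f.scaled b c (f.slope p r, 1)} =
      Submodule.span K {f.scaled b' c' (f.slope p r, 1)}) : b * c' = c * b' := by
  have hmem := e ▸ Submodule.mem_span_singleton_self (R := K) (f.scaled b c (f.slope p r, 1))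
  obtain ⟨k, hk⟩ := Submodule.mem_span_singleton.1 hmem
  rw [← map_smul, Prod.smul_mk, scaled_apply, scaled_apply] at hk
  have e2 := (f.coords_inj (atInf_injective hk)).2
  have hl := linForm_ne_zero f.not_mem h
  have hl' := linForm_ne_zero f.not_mem h'
  rw [Algebra.smul_def] at e2
  field_simp at e2
  refine mul_eq_mul_of_linForm_sq hF f.not_mem (z := k⁻¹ * b') (w := k⁻¹ * c') ?_
  have hk0 : algebraMap K F k ≠ 0 := by
    intro h0
    rw [h0, zero_mul] at e2
    exact pow_ne_zero 2 hl' e2.symm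
  rw [linForm_mul, map_inv₀]
  field_simp
  linear_combination e2

include hT

theorem setOf_lines_thru {α : Type*} (φ : Set (PG2 F) → α) :
    {x | ∃ m, IsLineOf f.plane m ∧ T ∈ m ∧ x = φ m} =
      {x | ∃ b c : K, (b, c) ≠ 0 ∧ x = φ (f.thru b c)} := by
  ext x
  constructor
  · rintro ⟨m, hm, hTm, rfl⟩
    rcases f.isLineOf_iff.1 hm with ⟨b, c, h, rfl⟩ | ⟨p, r, rfl⟩
    · exact ⟨b, c, h, rfl⟩
    · exact absurd hTm (f.not_mem_skew_of_infinity hT p r)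
  · rintro ⟨b, c, h, rfl⟩
    exact ⟨_, f.isLineOf_thru h, f.mem_thru_of_infinity hT b c, rfl⟩

include hF

theorem mul_eq_mul_of_tracePlane_inf_eq {b c b' c' : K} (h : (b, c) ≠ 0) (h' : (b', c') ≠ 0)
    (e : tracePlane K f.plane T (f.thru b c) ⊓ spreadElt K T =
      tracePlane K f.plane T (f.thru b' c') ⊓ spreadElt K T) : b * c' = c * b' :=
  mul_eq_mul_of_mem_tracePlane_inf hT hF h h' (e ▸ conicVec_mem_tracePlane_inf hT hF h')

/-- The planes are already told apart by their intersections with [T], each of which contains just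
one point of the conic. -/
theorem ncard_tracePlane_image [Finite K] :
    (tracePlane K f.plane T '' {m | IsLineOf f.plane m ∧ T ∈ m}).ncard = Nat.card K + 1 := by
  have : tracePlane K f.plane T '' {m | IsLineOf f.plane m ∧ T ∈ m} =
      {x | ∃ m, IsLineOf f.plane m ∧ T ∈ m ∧ x = tracePlane K f.plane T m} := by
    ext x
    constructor
    · rintro ⟨m, ⟨h1, h2⟩, rfl⟩
      exact ⟨m, h1, h2, rfl⟩
    · rintro ⟨m, h1, h2, rfl⟩
      exact ⟨m, ⟨h1, h2⟩, rfl⟩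
  rw [this, setOf_lines_thru hT]
  refine ncard_of_homogeneous (fun b c => tracePlane K f.plane T (f.thru b c))
    (fun k hk b c => by rw [f.thru_smul hk]) fun b c b' c' h h' e => ?_
  exact mul_eq_mul_of_tracePlane_inf_eq hT hF h h' (congrArg (· ⊓ spreadElt K T) e)

theorem setOf_tracePlane_inf_eq :
    {t | ∃ m, IsLineOf f.plane m ∧ T ∈ m ∧ t = tracePlane K f.plane T m ⊓ spreadElt K T} =
      {t | IsTangentLine T f.conic t} := by
  rw [setOf_lines_thru hT fun m => tracePlane K f.plane T m ⊓ spreadElt K T]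
  ext t
  constructor
  · rintro ⟨b, c, h, rfl⟩
    exact isTangentLine_tracePlane_inf hT hF h
  · exact exists_of_isTangentLine hT hF

theorem ncard_isTangentLine [Finite K] :
    {t | IsTangentLine T f.conic t}.ncard = Nat.card K + 1 := by
  rw [← setOf_tracePlane_inf_eq hT hF,
    setOf_lines_thru hT fun m => tracePlane K f.plane T m ⊓ spreadElt K T]
  exact ncard_of_homogeneous (fun b c => tracePlane K f.plane T (f.thru b c) ⊓ spreadElt K T)
    (fun k hk b c => by rw [f.thru_smul hk])
    fun b c b' c' h h' e => mul_eq_mul_of_tracePlane_inf_eq hT hF h h' e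

theorem setOf_tracePlane_inf_spreadElt_eq {L : PG2 F} {p r : K}
    (hL : L.submodule = Submodule.span F {![(f.dir p r).1, (f.dir p r).2, 0]}) :
    {W | ∃ m, IsLineOf f.plane m ∧ T ∈ m ∧ W = tracePlane K f.plane T m ⊓ spreadElt K L} =
      Projectivization.submodule '' shadow K (f.skew p r) := by
  rw [setOf_lines_thru hT fun m => tracePlane K f.plane T m ⊓ spreadElt K L,
    image_shadow_skew hF]
  ext W
  refine exists_congr fun b => exists_congr fun c => and_congr_right fun h => ?_
  rw [tracePlane_inf_spreadElt hT hF hL h]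

omit hT in
theorem ncard_shadow_skew [Finite K] (p r : K) :
    (shadow K (f.skew p r)).ncard = Nat.card K + 1 := by
  rw [← Set.ncard_image_of_injective _ Projectivization.submodule_injective,
    image_shadow_skew hF]
  refine ncard_of_homogeneous
    (fun b c => Submodule.span K {f.scaled b c (f.slope p r, 1)}) ?_
    fun b c b' c' h h' e => mul_eq_mul_of_span_scaled_eq hF h h' e
  intro k hk b c
  -- Homogeneity of degree -2 makes the span depend only on the ratio (b : c).
  have e : f.scaled (k * b) (k * c) (f.slope p r, 1) =
      (k⁻¹ ^ 2) • f.scaled b c (f.slope p r, 1) := by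
    rw [scaled_slope, scaled_slope, ← map_smul, ← algebraMap_smul F (k⁻¹ ^ 2), smul_smul,
      linForm_mul, map_pow, map_inv₀]
    congr 2
    rw [one_div, mul_pow, mul_inv, inv_pow, one_div]
  rw [e, span_singleton_smul (pow_ne_zero 2 (inv_ne_zero hk))]

end Frame

end BruckBose

/-! ### The theorem, read off in frame coordinates -/

theorem theorem4p1 {K F : Type*} [Field K] [Finite K] [Field F] [Algebra K F]
    (hF : Module.finrank K F = 3)
    (B : Set (PG2 F)) (T : PG2 F) (hB : IsTangentSubplane K B T) :
    -- the points `I_{P,l}` are well defined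
    (∀ l, IsLineOf B l → T ∉ l → ∀ P ∈ l, ∃! I : PG6 K F, IsTangentTrace P l I) ∧
    -- the conic directrix `C` exists, is unique, and has the three properties below
    ∃ C : Set (PG6 K F), IsConicDirectrix B T C ∧ (∀ C', IsConicDirectrix B T C' → C' = C) ∧
      -- part 1
      (∀ P ∈ B, P ≠ T →
        (tracesAt K B T P).ncard = Nat.card K ∧
        Module.finrank K (traceLine K B T P) = 2 ∧
        ∃ X ∈ C, traceLine K B T P ⊓ spreadElt K T = X.submodule) ∧
      -- part 2
      (∀ m, IsLineOf B m → T ∈ m →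
        (traceLine K B T '' (m \ {T})).ncard = Nat.card K ∧
        IsCoverPlane B (tracePlane K B T m) ∧
        IsTangentLine T C (tracePlane K B T m ⊓ spreadElt K T)) ∧
      -- part 3
      (tracePlane K B T '' {m | IsLineOf B m ∧ T ∈ m}).ncard = Nat.card K + 1 ∧
      (∀ L ∈ splash B, L ≠ T →
        (∃! l, IsLineOf B l ∧ L.submodule ≤ extLine l) ∧
        ∀ l, IsLineOf B l → L.submodule ≤ extLine l →
          (shadow K l).ncard = Nat.card K + 1 ∧
          {W | ∃ m, IsLineOf B m ∧ T ∈ m ∧ W = tracePlane K B T m ⊓ spreadElt K L} =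
            Projectivization.submodule '' shadow K l) ∧
      {t | ∃ m, IsLineOf B m ∧ T ∈ m ∧ t = tracePlane K B T m ⊓ spreadElt K T} =
        {t | IsTangentLine T C t} ∧
      {t | IsTangentLine T C t}.ncard = Nat.card K + 1 := by
  obtain ⟨f, rfl, hT⟩ := Frame.exists_frame hB
  have hne : ∀ m, IsLineOf f.plane m → T ∈ m → ∃ b c : K, (b, c) ≠ 0 ∧ m = f.thru b c := by
    intro m hm hTm
    rcases f.isLineOf_iff.1 hm with h | ⟨p, r, rfl⟩
    · exact h
    · exact absurd hTm (f.not_mem_skew_of_infinity hT p r)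
  refine ⟨?_, f.conic, Frame.isConicDirectrix_conic hT hF,
    fun C' hC' => Frame.eq_conic_of_isConicDirectrix hT hF hC', ?_, ?_,
    Frame.ncard_tracePlane_image hT hF, ?_, Frame.setOf_tracePlane_inf_eq hT hF,
    Frame.ncard_isTangentLine hT hF⟩
  · intro l hl hTl P hP
    rcases f.isLineOf_iff.1 hl with ⟨b, c, -, rfl⟩ | ⟨p, r, rfl⟩
    · exact absurd (f.mem_thru_of_infinity hT b c) hTl
    · exact Frame.existsUnique_isTangentTrace_skew hF hP
  · intro P hP hPT
    obtain ⟨a, b, c, h, e⟩ := f.exists_of_ne_infinity hT hP hPT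
    refine ⟨Frame.ncard_tracesAt hT hF h e, Frame.finrank_traceLine hT hF h e,
      Projectivization.mk K _ (f.conicVec_ne h),
      ⟨b, c, h, Projectivization.submodule_mk _ _⟩, ?_⟩
    rw [Frame.traceLine_inf hT hF h e, Projectivization.submodule_mk]
  · intro m hm hTm
    obtain ⟨b, c, h, rfl⟩ := hne m hm hTm
    exact ⟨Frame.ncard_traceLine_image hT hF h, Frame.isCoverPlane_tracePlane hT hF h,
      Frame.isTangentLine_tracePlane_inf hT hF h⟩
  · intro L hL hLT
    obtain ⟨p, r, e⟩ := Frame.exists_skew_of_mem_splash hT hL hLT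
    have hiff := fun l => Frame.eq_skew_iff hT hL.1 hLT e (l := l)
    refine ⟨⟨f.skew p r, (hiff _).2 rfl, fun l hl => (hiff l).1 hl⟩, fun l hl hle => ?_⟩
    obtain rfl := (hiff l).1 ⟨hl, hle⟩
    exact ⟨Frame.ncard_shadow_skew hF p r, Frame.setOf_tracePlane_inf_spreadElt_eq hT hF e⟩
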